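/- Let $m\ge 1$ and let $\Sigma=\{\alpha_1,\dots,\alpha_m,\beta_1,\dots,\beta_m\}$. Let $M$ be the monoid with zero generated by $\Sigma$ with relations $\alpha_j\beta_j=1$ for all $j$ and $\alpha_i\beta_j=0$ for $i\neq j$. The two-sided $m$-Dyck shift is $$X=\{x\in\Sigma^{\mathbb Z}:\ \text{every finite block } x_r x_{r+1}\cdots x_l \text{ is nonzero in } M\},$$ with the shift $(Tx)_n=x_{n+1}$. For $z\in\{0,1\}^{\mathbb Z}$ let $H_i(z)$, $i\in\mathbb Z$, be the walk with $H_0(z)=0$, $H_{i+1}(z)-H_i(z)=1$ if $z_i=1$ and $=-1$ if $z_i=0$. Let $S$ be the set of $z$ with $\inf_{n\ge 0}H_n(z)=\inf_{n<0}H_n(z)=-\infty$. Put $\gamma_k(z)=\sum_{i=0}^{k}z_i$ for $k\ge 0$, $\gamma_k(z)=-\sum_{i=k}^{-1}z_i$ for $k<0$, and $\varepsilon_n(z)=\max\{l<n: H_l(z)\le H_{n+1}(z)\}$. Define $F:S\times\{1,\dots,m\}^{\mathbb Z}\to X$ by $F(z,a)_n=\alpha_j$ with $j=a_{\gamma_n(z)}$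 if $z_n=1$, and $F(z,a)_n=\beta_j$ with $j=a_{\gamma_k(z)}$, $k=\varepsilon_n(z)$, if $z_n=0$. Let $\tilde\mu=(\mu_1\times\mu_2)\circ F^{-1}$, where $\mu_1$ and $\mu_2$ are the symmetric (uniform) product measures on $\{0,1\}^{\mathbb Z}$ and $\{1,\dots,m\}^{\mathbb Z}$. Call a measure $\mu$ on $X$ double-tail invariant if $\mu(A)=\mu(g(A))$ for every Borel set $A\subseteq X$ and every injective Borel map $g:A\to X$ such that for each $x\in A$ there is $n\ge 0$ with $x_k=g(x)_k$ for all $|k|>n$. **Proposition.** $\tilde\mu$ is a probability measure on $X$ that is both $T$-invariant and double-tail invariant, and its measure-theoretic (Kolmogorov–Sinai) entropy is $$h_{\tilde\mu}(X,T)=\log 2+\tfrac12\log m .$$ If $m\ge 2$, then $h_{\tilde\mu}(X,T)<h_{\mathrm{top}}(X,T)$, the topological entropy of $X$; in particular $\tilde\mu$ is not a measure of maximal entropy. -/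

import Mathlib

open MeasureTheory Filter

noncomputable section

/-! ### Entropy of a measure-preserving transformation -/

/-- The Shannon entropy (natural logarithm) of the finite partition of `Ω` into the fibres
of `f : Ω → ι`; recall `Real.negMulLog p = -p * log p`, with value `0` at `p = 0`. -/
def shannonEntropy {Ω ι : Type*} [MeasurableSpace Ω] [Fintype ι] (μ : Measure Ω)
    (f : Ω → ι) : ℝ :=
  ∑ i, Real.negMulLog (μ.real (f ⁻¹' {i}))

/-- The labelling of the join `P ∨ T⁻¹P ∨ ⋯ ∨ T^{-(n-1)}P`, where `P : Ω → Fin k` labels a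
partition. -/
def itinerary {Ω : Type*} {k : ℕ} (T : Ω → Ω) (P : Ω → Fin k) (n : ℕ) (x : Ω) : Fin n → Fin k :=
  fun i => P (T^[i] x)

/-- The entropy `h_μ(T, P) = lim_n (1/n) H_μ(P ∨ T⁻¹P ∨ ⋯ ∨ T^{-(n-1)}P)` of `T` relative to a
finite partition `P`. (For an invariant probability the limit exists.) -/
def partitionEntropy {Ω : Type*} [MeasurableSpace Ω] {k : ℕ} (μ : Measure Ω) (T : Ω → Ω)
    (P : Ω → Fin k) : EReal :=
  limsup (fun n : ℕ => ((shannonEntropy μ (itinerary T P n) / (n : ℝ) : ℝ) : EReal)) atTop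

/-- The Kolmogorov–Sinai entropy `h_μ(T)`: the supremum of `h_μ(T, P)` over all finite measurable
partitions `P`. -/
def measureEntropy {Ω : Type*} [MeasurableSpace Ω] (μ : Measure Ω) (T : Ω → Ω) : EReal :=
  ⨆ (k : ℕ) (P : Ω → Fin k) (_ : Measurable P), partitionEntropy μ T P

/-! ### The Dyck shift -/

/-- The alphabet `{α_j} ∪ {β_j}`, with `j` ranging over `m` colours. -/
inductive DyckLetter (m : ℕ) : Type
  | alpha (j : Fin m) : DyckLetter m
  | beta (j : Fin m) : DyckLetter m

/-- All subsets of the finite alphabet are measurable. -/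
instance (m : ℕ) : MeasurableSpace (DyckLetter m) := ⊤

/-- The alphabet is discrete. -/
instance (m : ℕ) : UniformSpace (DyckLetter m) := ⊥

/-- The free monoid with zero on the alphabet, of which the Dyck monoid is a quotient. -/
abbrev FreeDyck (m : ℕ) : Type := WithZero (FreeMonoid (DyckLetter m))

/-- A letter as an element of the free monoid with zero. -/
def DyckLetter.gen {m : ℕ} (s : DyckLetter m) : FreeDyck m :=
  ((FreeMonoid.of s : FreeMonoid (DyckLetter m)) : FreeDyck m)

/-- The defining relations: `α_j β_j = 1`, and `α_i β_j = 0` for `i ≠ j`. -/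
inductive DyckRel (m : ℕ) : FreeDyck m → FreeDyck m → Prop
  | matched (j : Fin m) :
      DyckRel m ((DyckLetter.alpha j).gen * (DyckLetter.beta j).gen) 1
  | mismatched (i j : Fin m) (h : i ≠ j) :
      DyckRel m ((DyckLetter.alpha i).gen * (DyckLetter.beta j).gen) 0

/-- The congruence "equal modulo `M`", `M` being the monoid with zero generated by the alphabet
subject to the relations `DyckRel`. -/
def dyckCon (m : ℕ) : Con (FreeDyck m) := conGen (DyckRel m)

/-- The `m`-Dyck language: the words that are nonzero modulo `M`. -/
def dyckLanguage (m : ℕ) : Set (List (DyckLetter m)) :=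
  {w | ¬ dyckCon m ((FreeMonoid.ofList w : FreeMonoid (DyckLetter m)) : FreeDyck m) 0}

/-- The word `x_r x_{r+1} ⋯ x_{r+n-1}` of a bi-infinite sequence. -/
def factorWord {A : Type*} (x : ℤ → A) (r : ℤ) (n : ℕ) : List A :=
  List.ofFn fun i : Fin n => x (r + (i : ℕ))

/-- The two-sided `m`-Dyck shift, as a set of bi-infinite sequences. -/
def dyckShift (m : ℕ) : Set (ℤ → DyckLetter m) :=
  {x | ∀ (r : ℤ) (n : ℕ), factorWord x r n ∈ dyckLanguage m}

/-- The two-sided `m`-Dyck shift `X` as a space, with the uniform (hence topological) and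
measurable structures it inherits from the product space `Σ^ℤ`. -/
abbrev DyckShift (m : ℕ) : Type := dyckShift m

/-- The left shift `T` on the Dyck shift: `(T x)_n = x_{n+1}`. -/
def DyckShift.shift {m : ℕ} (x : DyckShift m) : DyckShift m :=
  ⟨fun n => x.1 (n + 1), fun r n => by
    have h := x.2 (r + 1) n
    have e : factorWord (fun n => x.1 (n + 1)) r n = factorWord x.1 (r + 1) n := by
      unfold factorWord
      congr 1
      funext i
      exact congrArg x.1 (by ring)
    rw [e]
    exact h⟩

/-- The double-tail (homoclinic) relation `T₂(X)`. -/
def DyckShift.DoubleTail {m : ℕ} (x x' : DyckShift m) : Prop :=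
  ∃ n : ℕ, ∀ k : ℤ, (n : ℤ) < |k| → x.1 k = x'.1 k

/-- `μ` is double-tail invariant: `μ(A) = μ(g(A))` for every injective Borel map `g` from a Borel
set `A` into `X` whose graph lies in the double-tail relation. -/
def DoubleTailInvariant {m : ℕ} (μ : Measure (DyckShift m)) : Prop :=
  ∀ A : Set (DyckShift m), MeasurableSet A → ∀ g : A → DyckShift m, Measurable g →
    Function.Injective g → (∀ x : A, DyckShift.DoubleTail (x : DyckShift m) (g x)) →
      μ A = μ (Set.range g)

/-! ### The measure `μ̃` -/

/-- The height function of `z ∈ {0,1}^ℤ` (`true` is `1`, `false` is `0`): the two-sided walk with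
`height z 0 = 0` and `height z (i+1) - height z i` equal to `1` if `z_i = 1` and to `-1` if
`z_i = 0`. -/
def height (z : ℤ → Bool) (i : ℤ) : ℤ :=
  if 0 ≤ i then ∑ j ∈ Finset.Ico 0 i, (if z j then 1 else -1)
  else ∑ j ∈ Finset.Ico i 0, (if z j then -1 else 1)

/-- The set of `z` for which the height is unbounded below in both directions. -/
def unboundedBelow : Set (ℤ → Bool) :=
  {z | (∀ c : ℤ, ∃ n : ℤ, 0 ≤ n ∧ height z n < c) ∧ (∀ c : ℤ, ∃ n : ℤ, n < 0 ∧ height z n < c)}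

/-- `γ_k(z)`: a signed count of the ones of `z` between `0` and `k`; it is injective on
`{k | z_k = 1}`. -/
def onesIndex (z : ℤ → Bool) (k : ℤ) : ℤ :=
  if 0 ≤ k then ∑ i ∈ Finset.Icc 0 k, (if z i then 1 else 0)
  else -∑ i ∈ Finset.Ico k 0, (if z i then 1 else 0)

/-- `ε_n(z) = max {l < n | H_l(z) ≤ H_{n+1}(z)}`. The set is bounded above by `n`, and nonempty
when `z ∈ unboundedBelow`, so the supremum is then a maximum. -/
def partner (z : ℤ → Bool) (n : ℤ) : ℤ :=
  sSup {l : ℤ | l < n ∧ height z l ≤ height z (n + 1)}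

/-- The map `F`, of interest on `unboundedBelow ×ˢ univ`: position `n` of `F (z, a)` is `α_j` with
`j = a_{γ_n(z)}` if `z_n = 1`, and `β_j` with `j = a_{γ_k(z)}`, `k = ε_n(z)`, if `z_n = 0`. -/
def colourMap (m : ℕ) (p : (ℤ → Bool) × (ℤ → Fin m)) (n : ℤ) : DyckLetter m :=
  if p.1 n then DyckLetter.alpha (p.2 (onesIndex p.1 n))
  else DyckLetter.beta (p.2 (onesIndex p.1 (partner p.1 n)))

/-- The symmetric product measure on `A^ℤ`, for a finite set `A`. -/
def symmetricProduct (A : Type) [MeasurableSpace A] : Measure (ℤ → A) :=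
  Measure.infinitePi fun _ : ℤ => ProbabilityTheory.uniformOn (Set.univ : Set A)

/-- The measure `μ̃ = (μ₁ × μ₂) ∘ F⁻¹` on the Dyck shift `X`, where `μ₁` and `μ₂` are the symmetric
product measures on `{0,1}^ℤ` and on `{1,…,m}^ℤ`, and `F` is defined on `unboundedBelow ×ˢ univ`:
for Borel `B ⊆ X`, `μ̃(B)` is the `μ₁ × μ₂`-measure of the set of `(z, a)` in
`unboundedBelow ×ˢ univ` with `F (z, a) ∈ B`. -/
def thirdMeasure (m : ℕ) : Measure (DyckShift m) :=
  Measure.comap (Subtype.val : DyckShift m → ℤ → DyckLetter m)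
    ((((symmetricProduct Bool).prod (symmetricProduct (Fin m))).restrict
      (unboundedBelow ×ˢ Set.univ)).map (colourMap m))

end

noncomputable section

/-! ### The walk of heights -/

/-! Everything follows from the values of the measure on cylinders. Read `α` as an opening and `β`
as a closing bracket. Almost every walk is unbounded below in both directions, so every bracket has
a partner and each matched pair carries one independent uniform colour. A word of length `N` in
which matched brackets have equal colours therefore has measure `2^(-N) * m^(-D)`, where `D` counts
the pairs that meet the window (`dyckLaw_cyl`). Points of `X` contain only such words
(`consistent_of_mem`), and `D` depends only on the word, which gives shift invariance.

For double-tail invariance, a Borel map with graph in the tail relation is, on countably many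
pieces, the replacement of one word over `[-k, k]` by another (`dyckLaw_image_splice`). If both
words make the walk rise equally, then `2D = N + H(s) + H(r) - 2 min H` (`exists_min_card_freshSet`)
shows that large cylinders around a point and its image have the same `D`, hence the same measure,
and this passes to Borel sets (`measure_eq_of_eventually_cyl_eq`). If the rises differ, the closing
brackets far to the right are matched with openings at two different depths of the stack on the
left, so the colours in the stack are eventually periodic (`stackPeriodic_of_rise_ne`). For `m ≥ 2`
this is a null event; for `m = 1` the exponent `D` is irrelevant.

By the same formula a window of `N` letters has entropy `N log 2 + E[D] log m`. A position adds to
`D` if it opens a bracket or closes one opened before the window; the probability of this tends to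
`1/2`, since closing brackets are almost surely matched. The letter at zero generates: any partition
is approximated by one that reads a finite window, and a coding inequality bounds the loss
(`shannonEntropy_le_add`). Finally, openings with their colours and closings without colours can be
prescribed freely, so the topological entropy is at least `log (m + 1)`, which exceeds `log (2 √m)`
when `m ≥ 2`. -/

theorem height_zero (z : ℤ → Bool) : height z 0 = 0 := by simp [height]

theorem height_succ (z : ℤ → Bool) (n : ℤ) :
    height z (n + 1) = height z n + if z n then 1 else -1 := by
  unfold height
  rcases lt_trichotomy n (-1) with h | h | h
  · rw [if_neg (by omega), if_neg (by omega), ← Finset.insert_Ico_add_one_left_eq_Ico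
      (show n < 0 by omega), Finset.sum_insert (by simp)]
    split_ifs <;> ring
  · subst h
    rw [if_pos (by omega), if_neg (by omega), ← Finset.insert_Ico_add_one_left_eq_Ico
      (show (-1 : ℤ) < 0 by omega), Finset.sum_insert (by simp)]
    simp
    split_ifs <;> ring
  · rw [if_pos (by omega), if_pos (by omega), ← Finset.insert_Ico_right_eq_Ico_add_one
      (show (0 : ℤ) ≤ n by omega), Finset.sum_insert (by simp)]
    ring

theorem height_succ_of_true {z : ℤ → Bool} {n : ℤ} (h : z n = true) :
    height z (n + 1) = height z n + 1 := by simp [height_succ, h]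

theorem height_succ_of_false {z : ℤ → Bool} {n : ℤ} (h : z n = false) :
    height z (n + 1) = height z n - 1 := by simp [height_succ, h]; ring

theorem height_succ_cases (z : ℤ → Bool) (n : ℤ) :
    (z n = true ∧ height z (n + 1) = height z n + 1) ∨
      (z n = false ∧ height z (n + 1) = height z n - 1) := by
  cases h : z n
  · exact Or.inr ⟨rfl, height_succ_of_false h⟩
  · exact Or.inl ⟨rfl, height_succ_of_true h⟩

theorem height_sub_congr {z z' : ℤ → Bool} {r n : ℤ} (hrn : r ≤ n)
    (h : ∀ i, r ≤ i → i < n → z i = z' i) :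
    height z n - height z r = height z' n - height z' r := by
  induction n, hrn using Int.leInduction with
  | base => simp
  | succ n hn ih =>
    have := ih fun i h1 h2 => h i h1 (by omega)
    rw [height_succ, height_succ, h n hn (by omega)]
    linarith

/-- A walk that gets down to the level `c` hits it. -/
theorem exists_first_passage {z : ℤ → Bool} {r c : ℤ} (hr : c ≤ height z r)
    (hs : ∃ s, r ≤ s ∧ height z s ≤ c) :
    ∃ i, r ≤ i ∧ height z i = c ∧ ∀ j, r ≤ j → j < i → c < height z j := by
  obtain ⟨i, ⟨h1, h2⟩, h3⟩ := Int.exists_least_of_bdd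
    (P := fun s => r ≤ s ∧ height z s ≤ c) ⟨r, fun s hs => hs.1⟩ hs
  have h4 : ∀ j, r ≤ j → j < i → c < height z j := fun j hj1 hj2 => by
    by_contra hj3
    have := h3 j ⟨hj1, by omega⟩
    omega
  refine ⟨i, h1, ?_, h4⟩
  -- The walk moves by unit steps, so the first time at or below `c` it is exactly at `c`.
  rcases h1.eq_or_lt with rfl | h
  · omega
  · have h5 := h4 (i - 1) (by omega) (by omega)
    have h6 := height_succ_cases z (i - 1)
    rw [sub_add_cancel] at h6
    omega

/-! ### Matching brackets -/

/-- The bracket opened at `l` is closed at `n`. -/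
structure IsMatch (z : ℤ → Bool) (l n : ℤ) : Prop where
  lt : l < n
  closes : z n = false
  le : height z l ≤ height z (n + 1)
  above : ∀ i, l < i → i < n → height z (n + 1) < height z i

theorem IsMatch.lt_height {z : ℤ → Bool} {l n : ℤ} (h : IsMatch z l n) {i : ℤ} (h1 : l < i)
    (h2 : i ≤ n) : height z (n + 1) < height z i := by
  rcases h2.eq_or_lt with rfl | h3
  · rw [height_succ_of_false h.closes]; omega
  · exact h.above i h1 h3

/-- The walk is strictly above the final height at `l + 1` and at most at that height at `l`, so it
steps up at `l`. -/
theorem IsMatch.opens {z : ℤ → Bool} {l n : ℤ} (h : IsMatch z l n) : z l = true := by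
  have h1 := h.lt_height (i := l + 1) (by omega) (by have := h.lt; omega)
  have h2 := h.le
  rcases height_succ_cases z l with ⟨h3, _⟩ | ⟨_, h4⟩
  · exact h3
  · omega

theorem IsMatch.height_eq {z : ℤ → Bool} {l n : ℤ} (h : IsMatch z l n) :
    height z l = height z (n + 1) := by
  have h1 := h.lt_height (i := l + 1) (by omega) (by have := h.lt; omega)
  have h2 := h.le
  have h3 := height_succ_of_true h.opens
  omega

theorem IsMatch.congr {z z' : ℤ → Bool} {l n : ℤ} (h : IsMatch z l n)
    (hz : ∀ i, l ≤ i → i ≤ n → z i = z' i) : IsMatch z' l n := by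
  have key : ∀ i, l ≤ i → i ≤ n + 1 → height z i - height z l = height z' i - height z' l :=
    fun i h1 h2 => height_sub_congr h1 fun j h3 h4 => hz j h3 (by omega)
  have hl := h.lt
  have hn := key (n + 1) (by omega) le_rfl
  refine ⟨hl, by rw [← hz n (by omega) le_rfl, h.closes], ?_, fun i h1 h2 => ?_⟩
  · have := h.le; omega
  · have := h.above i h1 h2
    have := key i (by omega) (by omega)
    omega

theorem isGreatest_sSup_int {s : Set ℤ} (hne : s.Nonempty) (hb : BddAbove s) :
    IsGreatest s (sSup s) := ⟨Int.csSup_mem hne hb, fun _ hx => le_csSup hb hx⟩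

theorem isGreatest_partner {z : ℤ → Bool} {n : ℤ} (h : ∃ l, l < n ∧ height z l ≤ height z (n + 1)) :
    IsGreatest {l : ℤ | l < n ∧ height z l ≤ height z (n + 1)} (partner z n) :=
  isGreatest_sSup_int h ⟨n, fun _ hl => hl.1.le⟩

theorem isMatch_partner {z : ℤ → Bool} {n : ℤ} (hn : z n = false)
    (h : ∃ l, l < n ∧ height z l ≤ height z (n + 1)) : IsMatch z (partner z n) n := by
  have hg := isGreatest_partner h
  refine ⟨hg.1.1, hn, hg.1.2, fun i h1 h2 => ?_⟩
  by_contra h3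
  have := hg.2 (show i ∈ _ from ⟨h2, by omega⟩)
  omega

theorem IsMatch.partner_eq {z : ℤ → Bool} {l n : ℤ} (h : IsMatch z l n) : partner z n = l := by
  have hg := isGreatest_partner ⟨l, h.lt, h.le⟩
  refine le_antisymm ?_ (hg.2 ⟨h.lt, h.le⟩)
  by_contra h1
  have := h.above _ (lt_of_not_ge h1) hg.1.1
  have := hg.1.2
  omega

theorem IsMatch.right_unique {z : ℤ → Bool} {l n n' : ℤ} (h : IsMatch z l n)
    (h' : IsMatch z l n') : n = n' := by
  have e := h.height_eq
  have e' := h'.height_eq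
  have hl := h.lt
  have hl' := h'.lt
  rcases lt_trichotomy n n' with h1 | h1 | h1
  · have := h'.lt_height (i := n + 1) (by omega) (by omega)
    omega
  · exact h1
  · have := h.lt_height (i := n' + 1) (by omega) (by omega)
    omega

theorem exists_left_le {z : ℤ → Bool} (hz : z ∈ unboundedBelow) (n c : ℤ) :
    ∃ l, l < n ∧ height z l ≤ c := by
  -- a point of the walk below both `c` and all heights between `n` and `0`
  obtain ⟨b, hb⟩ : ∃ b : ℤ, ∀ l ∈ Set.Icc n 0, b ≤ height z l := by
    obtain ⟨b, hb⟩ := ((Set.finite_Icc n 0).image (height z)).bddBelow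
    exact ⟨b, fun l hl => hb ⟨l, hl, rfl⟩⟩
  obtain ⟨l, hl, hlc⟩ := hz.2 (min b c)
  refine ⟨l, ?_, ?_⟩
  · by_contra h
    have := hb l ⟨by omega, by omega⟩
    omega
  · omega

theorem exists_right_le {z : ℤ → Bool} (hz : z ∈ unboundedBelow) (n c : ℤ) :
    ∃ l, n ≤ l ∧ height z l ≤ c := by
  obtain ⟨b, hb⟩ : ∃ b : ℤ, ∀ l ∈ Set.Icc 0 n, b ≤ height z l := by
    obtain ⟨b, hb⟩ := ((Set.finite_Icc 0 n).image (height z)).bddBelow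
    exact ⟨b, fun l hl => hb ⟨l, hl, rfl⟩⟩
  obtain ⟨l, hl, hlc⟩ := hz.1 (min b c)
  refine ⟨l, ?_, ?_⟩
  · by_contra h
    have := hb l ⟨by omega, by omega⟩
    omega
  · omega

theorem isMatch_partner_of_mem {z : ℤ → Bool} (hz : z ∈ unboundedBelow) {n : ℤ}
    (hn : z n = false) : IsMatch z (partner z n) n :=
  isMatch_partner hn (exists_left_le hz n _)

/-! ### Colour classes met by a window -/

/-- The bracket at `n` is not closing a bracket that is opened in `[r, n)`. -/
def Fresh (z : ℤ → Bool) (r n : ℤ) : Prop :=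
  z n = true ∨ ∀ l, r ≤ l → l < n → height z (n + 1) < height z l

theorem Fresh.congr {z z' : ℤ → Bool} {r n : ℤ} (h : Fresh z r n)
    (hz : ∀ i, r ≤ i → i ≤ n → z i = z' i) (hr : r ≤ n) : Fresh z' r n := by
  have key : ∀ i, r ≤ i → i ≤ n + 1 → height z i - height z r = height z' i - height z' r :=
    fun i h1 h2 => height_sub_congr h1 fun j h3 h4 => hz j h3 (by omega)
  rcases h with h | h
  · exact Or.inl (by rw [← hz n hr le_rfl, h])
  · refine Or.inr fun l h1 h2 => ?_
    have := h l h1 h2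
    have := key l h1 (by omega)
    have := key (n + 1) (by omega) le_rfl
    omega

theorem fresh_congr {z z' : ℤ → Bool} {r n : ℤ} (hz : ∀ i, r ≤ i → i ≤ n → z i = z' i)
    (hr : r ≤ n) : Fresh z r n ↔ Fresh z' r n :=
  ⟨fun h => h.congr hz hr, fun h => h.congr (fun i h1 h2 => (hz i h1 h2).symm) hr⟩

/-- A low point of the walk inside the window already makes the set defining `partner` nonempty, so
the partner exists and cannot lie left of that point. -/
theorem exists_isMatch_of_not_fresh {z : ℤ → Bool} {r n : ℤ} (h : ¬ Fresh z r n) :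
    ∃ l, r ≤ l ∧ IsMatch z l n := by
  unfold Fresh at h
  push Not at h
  obtain ⟨hn, l, h1, h2, h3⟩ := h
  have hex : ∃ l, l < n ∧ height z l ≤ height z (n + 1) := ⟨l, h2, h3⟩
  exact ⟨partner z n, h1.trans ((isGreatest_partner hex).2 ⟨h2, h3⟩),
    isMatch_partner (by simpa using hn) hex⟩

open Classical in
/-- The positions of `[r, s)` which are the first of their colour class in this window. -/
def freshSet (z : ℤ → Bool) (r s : ℤ) : Finset ℤ := (Finset.Ico r s).filter (Fresh z r)

theorem mem_freshSet {z : ℤ → Bool} {r s n : ℤ} :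
    n ∈ freshSet z r s ↔ (r ≤ n ∧ n < s) ∧ Fresh z r n := by
  simp [freshSet]

theorem freshSet_congr {z z' : ℤ → Bool} {r s : ℤ} (hz : ∀ i, r ≤ i → i < s → z i = z' i) :
    freshSet z r s = freshSet z' r s := by
  ext n
  rw [mem_freshSet, mem_freshSet]
  refine and_congr_right fun h => fresh_congr (fun i h1 h2 => hz i h1 (by omega)) h.1

/-- Twice the number of colour classes met by a window, in terms of the walk. -/
theorem exists_min_card_freshSet (z : ℤ → Bool) {r s : ℤ} (hrs : r ≤ s) :
    ∃ l, r ≤ l ∧ l ≤ s ∧ (∀ i, r ≤ i → i ≤ s → height z l ≤ height z i) ∧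
      2 * ((freshSet z r s).card : ℤ) = (s - r) + height z s + height z r - 2 * height z l := by
  classical
  induction s, hrs using Int.leInduction with
  | base =>
    refine ⟨r, le_rfl, le_rfl, fun i h1 h2 => by rw [le_antisymm h1 h2], ?_⟩
    simp [freshSet]; ring
  | succ s hs ih =>
    obtain ⟨l, h1, h2, h3, h4⟩ := ih
    have hI : freshSet z r (s + 1) =
        if Fresh z r s then insert s (freshSet z r s) else freshSet z r s := by
      unfold freshSet
      rw [← Finset.insert_Ico_right_eq_Ico_add_one hs, Finset.filter_insert]
    have hns : s ∉ freshSet z r s := by simp [mem_freshSet]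
    -- Both sides grow by 2 for an opening bracket (length and final height each gain 1) and for a
    -- fresh closing one (length +1, height -1, a new minimum one lower). For a closing bracket
    -- matched inside the window, length and height cancel and the minimum stays.
    by_cases hf : Fresh z r s
    · rw [hI, if_pos hf, Finset.card_insert_of_notMem hns]
      rcases height_succ_cases z s with ⟨h5, h6⟩ | ⟨h5, h6⟩
      · refine ⟨l, h1, by omega, fun i h7 h8 => ?_, by push_cast; omega⟩
        rcases (show i ≤ s ∨ i = s + 1 by omega) with h | rfl
        · exact h3 i h7 h
        · have := h3 s hs le_rfl; omega
      · have hf' : ∀ l, r ≤ l → l ≤ s → height z (s + 1) < height z l := fun l h7 h8 => by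
          rcases h8.eq_or_lt with rfl | h8
          · omega
          · exact (hf.resolve_left (by simp [h5])) l h7 h8
        refine ⟨s + 1, by omega, le_rfl, fun i h7 h8 => ?_, ?_⟩
        · rcases (show i ≤ s ∨ i = s + 1 by omega) with h | rfl
          · exact (hf' i h7 h).le
          · exact le_rfl
        · have := hf' l h1 h2
          have := h3 s hs le_rfl
          push_cast; omega
    · rw [hI, if_neg hf]
      unfold Fresh at hf
      push Not at hf
      obtain ⟨h5, l', h6, h7, h8⟩ := hf
      have h9 := height_succ_of_false (by simpa using h5 : z s = false)
      refine ⟨l, h1, by omega, fun i h10 h11 => ?_, by omega⟩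
      rcases (show i ≤ s ∨ i = s + 1 by omega) with h | rfl
      · exact h3 i h10 h
      · exact (h3 l' h6 (by omega)).trans h8

/-! ### Colour indices -/

theorem onesIndex_injOn (z : ℤ → Bool) : Set.InjOn (onesIndex z) {k | z k = true} := by
  -- On the ones the index is strictly increasing: it is negative at negative positions and
  -- nonnegative at the others, so the two halves cannot collide.
  have key : ∀ i j, i < j → z i = true → z j = true → onesIndex z i < onesIndex z j := by
    intro i j hij hi hj
    unfold onesIndex
    rcases lt_or_ge i 0 with h | h
    · have hpos : 0 < ∑ k ∈ Finset.Ico i 0, (if z k then (1 : ℤ) else 0) :=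
        Finset.sum_pos' (fun k _ => by split_ifs <;> simp) ⟨i, by simp [h], by simp [hi]⟩
      rcases lt_or_ge j 0 with h' | h'
      · rw [if_neg (by omega), if_neg (by omega), neg_lt_neg_iff]
        refine Finset.sum_lt_sum_of_subset (i := i)
          (Finset.Ico_subset_Ico_left hij.le) (by simp [h]) (by simp [hij]) (by simp [hi])
          fun k _ _ => by split_ifs <;> simp
      · rw [if_neg (by omega), if_pos h']
        have : 0 ≤ ∑ k ∈ Finset.Icc 0 j, (if z k then (1 : ℤ) else 0) :=
          Finset.sum_nonneg fun k _ => by split_ifs <;> simp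
        omega
    · rw [if_pos h, if_pos (by omega)]
      refine Finset.sum_lt_sum_of_subset (i := j)
        (Finset.Icc_subset_Icc_right hij.le) (by simp; omega) (by simp [hij]) (by simp [hj])
        fun k _ _ => by split_ifs <;> simp
  intro i hi j hj h
  rcases lt_trichotomy i j with h1 | h1 | h1
  · exact absurd h (key i j h1 hi hj).ne
  · exact h1
  · exact absurd h (key j i h1 hj hi).ne'

/-- The position where the bracket at `n` is opened. -/
def opening (z : ℤ → Bool) (n : ℤ) : ℤ := if z n then n else partner z n

/-- The index of the colour of the bracket at `n`. -/
def colourIndex (z : ℤ → Bool) (n : ℤ) : ℤ := onesIndex z (opening z n)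

theorem opening_of_true {z : ℤ → Bool} {n : ℤ} (h : z n = true) : opening z n = n := by
  simp [opening, h]

theorem opening_of_false {z : ℤ → Bool} {n : ℤ} (h : z n = false) :
    opening z n = partner z n := by simp [opening, h]

theorem apply_opening {z : ℤ → Bool} (hz : z ∈ unboundedBelow) (n : ℤ) :
    z (opening z n) = true := by
  cases h : z n
  · rw [opening_of_false h]; exact (isMatch_partner_of_mem hz h).opens
  · rw [opening_of_true h, h]

theorem colourIndex_of_isMatch {z : ℤ → Bool} {l n : ℤ} (h : IsMatch z l n) :
    colourIndex z n = colourIndex z l := by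
  rw [colourIndex, colourIndex, opening_of_false h.closes, opening_of_true h.opens, h.partner_eq]

/-- Fresh openings start inside the window, fresh closings have their partner before `r`, and two
closings never share a partner. Hence the colours at fresh positions are independent. -/
theorem colourIndex_injOn_fresh {z : ℤ → Bool} (hz : z ∈ unboundedBelow) (r s : ℤ) :
    Set.InjOn (colourIndex z) (freshSet z r s) := by
  intro i hi j hj h
  have h1 : opening z i = opening z j :=
    onesIndex_injOn z (apply_opening hz i) (apply_opening hz j) h
  rw [Finset.mem_coe, mem_freshSet] at hi hj
  have low : ∀ n, Fresh z r n → z n = false → partner z n < r := by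
    intro n hf hn
    have hm := isMatch_partner_of_mem hz hn
    by_contra hc
    have := hf.resolve_left (by simp [hn]) _ (not_lt.1 hc) hm.lt
    have := hm.le
    omega
  cases hzi : z i <;> cases hzj : z j
  · rw [opening_of_false hzi, opening_of_false hzj] at h1
    have m1 := isMatch_partner_of_mem hz hzi
    rw [h1] at m1
    exact m1.right_unique (isMatch_partner_of_mem hz hzj)
  · rw [opening_of_false hzi, opening_of_true hzj] at h1
    have := low i hi.2 hzi
    omega
  · rw [opening_of_true hzi, opening_of_false hzj] at h1
    have := low j hj.2 hzj
    omega
  · rwa [opening_of_true hzi, opening_of_true hzj] at h1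

/-! ### Letters -/

/-- Whether a letter is an opening bracket. -/
def DyckLetter.isAlpha {m : ℕ} : DyckLetter m → Bool
  | alpha _ => true
  | beta _ => false

/-- The colour of a letter. -/
def DyckLetter.colour {m : ℕ} : DyckLetter m → Fin m
  | alpha j => j
  | beta j => j

theorem DyckLetter.ext' {m : ℕ} {s t : DyckLetter m} (h1 : s.isAlpha = t.isAlpha)
    (h2 : s.colour = t.colour) : s = t := by
  cases s <;> cases t <;> simp_all [isAlpha, colour]

theorem DyckLetter.eq_alpha {m : ℕ} {s : DyckLetter m} (h : s.isAlpha = true) :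
    s = alpha s.colour := by cases s <;> simp_all [isAlpha, colour]

theorem DyckLetter.eq_beta {m : ℕ} {s : DyckLetter m} (h : s.isAlpha = false) :
    s = beta s.colour := by cases s <;> simp_all [isAlpha, colour]

/-- The sequence of opening and closing brackets, without their colours. -/
def shape {m : ℕ} (x : ℤ → DyckLetter m) : ℤ → Bool := fun n => (x n).isAlpha

theorem shape_colourMap {m : ℕ} (p : (ℤ → Bool) × (ℤ → Fin m)) : shape (colourMap m p) = p.1 := by
  funext n
  cases h : p.1 n <;> simp [shape, colourMap, h, DyckLetter.isAlpha]

theorem colour_colourMap {m : ℕ} (p : (ℤ → Bool) × (ℤ → Fin m)) (n : ℤ) :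
    (colourMap m p n).colour = p.2 (colourIndex p.1 n) := by
  cases h : p.1 n <;> simp [colourMap, h, DyckLetter.colour, colourIndex, opening]

/-- In the window `[r, s)` brackets that match have the same colour. -/
def Consistent {m : ℕ} (y : ℤ → DyckLetter m) (r s : ℤ) : Prop :=
  ∀ l n, r ≤ l → n < s → IsMatch (shape y) l n → (y l).colour = (y n).colour

theorem consistent_colourMap {m : ℕ} (p : (ℤ → Bool) × (ℤ → Fin m)) (r s : ℤ) :
    Consistent (colourMap m p) r s := by
  intro l n _ _ h
  rw [shape_colourMap] at h
  rw [colour_colourMap, colour_colourMap, colourIndex_of_isMatch h]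

/-! ### The Dyck monoid acting on infinite stacks -/

/-- `α_j` pushes the colour `j` on the stack, `β_j` pops it and fails on any other colour. -/
def DyckLetter.act {m : ℕ} : DyckLetter m → Option (ℕ → Fin m) → Option (ℕ → Fin m)
  | alpha j, s => s.map fun t n => Nat.casesOn n j t
  | beta j, s => s.bind fun t => if t 0 = j then some fun n => t (n + 1) else none

/-- The action of a word on a stack, letters being read from the left. -/
def wordAct {m : ℕ} (w : List (DyckLetter m)) (s : Option (ℕ → Fin m)) : Option (ℕ → Fin m) :=
  w.foldl (fun t a => a.act t) s

theorem wordAct_append {m : ℕ} (v w : List (DyckLetter m)) (s : Option (ℕ → Fin m)) :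
    wordAct (v ++ w) s = wordAct w (wordAct v s) := List.foldl_append

theorem wordAct_none {m : ℕ} (w : List (DyckLetter m)) : wordAct w none = none := by
  induction w with
  | nil => rfl
  | cons a w ih => cases a <;> exact ih

/-- The action of the free monoid with zero on stacks. -/
def dyckAct {m : ℕ} (u : FreeDyck m) (s : Option (ℕ → Fin m)) : Option (ℕ → Fin m) :=
  Option.elim u none fun w => wordAct (FreeMonoid.toList w) s

theorem dyckAct_mul {m : ℕ} (u v : FreeDyck m) (s : Option (ℕ → Fin m)) :
    dyckAct (u * v) s = dyckAct v (dyckAct u s) := by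
  induction u using WithZero.recZeroCoe with
  | zero =>
    rw [zero_mul]
    induction v using WithZero.recZeroCoe with
    | zero => rfl
    | coe v => exact (wordAct_none _).symm
  | coe u =>
    induction v using WithZero.recZeroCoe with
    | zero => rw [mul_zero]; rfl
    | coe v => exact wordAct_append _ _ _

/-- Two elements of the free monoid with zero are identified if they act in the same way. -/
def actCon (m : ℕ) : Con (FreeDyck m) where
  r u v := ∀ s, dyckAct u s = dyckAct v s
  iseqv := ⟨fun _ _ => rfl, fun h s => (h s).symm, fun h h' s => (h s).trans (h' s)⟩
  mul' h h' s := by rw [dyckAct_mul, dyckAct_mul, h, h']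

/-- The defining relations hold for the action on stacks, which gives an invariant certifying that a
word is nonzero in `M`: it suffices that some stack survives it. -/
theorem dyckCon_le_actCon (m : ℕ) : dyckCon m ≤ actCon m := by
  refine Con.conGen_le.2 ?_
  rintro _ _ (⟨j⟩ | ⟨i, j, h⟩) s
  · rw [dyckAct_mul]
    cases s with
    | none => rfl
    | some t =>
      change (if j = j then some t else none) = some t
      simp
  · rw [dyckAct_mul]
    cases s with
    | none => rfl
    | some t =>
      change (if i = j then some t else none) = none
      simp [h]

theorem mem_dyckLanguage_of_wordAct {m : ℕ} {w : List (DyckLetter m)} {s : Option (ℕ → Fin m)}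
    (h : wordAct w s ≠ none) : w ∈ dyckLanguage m := fun h0 =>
  h (dyckCon_le_actCon m h0 s)

/-- The position where the `j`-th of the brackets that are open at time `n` was opened. -/
def openAt (z : ℤ → Bool) (n : ℤ) (j : ℕ) : ℤ :=
  sSup {l : ℤ | l < n ∧ height z l < height z n - j}

/-- This and the next three lemmas say that the stack of open positions is pushed by an opening
bracket and popped by a closing one. They compare the sets under the supremum, so they hold even
where no such position exists and `sSup` takes its default value. -/
theorem openAt_succ_of_true_zero {z : ℤ → Bool} {n : ℤ} (h : z n = true) :
    openAt z (n + 1) 0 = n := by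
  have hn : n ∈ {l : ℤ | l < n + 1 ∧ height z l < height z (n + 1) - (0 : ℕ)} := by
    have := height_succ_of_true h
    constructor
    · omega
    · push_cast; omega
  exact IsGreatest.csSup_eq ⟨hn, fun l hl => by have := hl.1; omega⟩

theorem openAt_succ_of_true_succ {z : ℤ → Bool} {n : ℤ} (h : z n = true) (j : ℕ) :
    openAt z (n + 1) (j + 1) = openAt z n j := by
  unfold openAt
  congr 1
  ext l
  have := height_succ_of_true h
  constructor <;> rintro ⟨h1, h2⟩ <;> push_cast at h2
  · refine ⟨?_, by omega⟩
    rcases (show l < n ∨ l = n by omega) with h3 | rfl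
    · exact h3
    · omega
  · refine ⟨by omega, ?_⟩
    push_cast; omega

theorem openAt_succ_of_false {z : ℤ → Bool} {n : ℤ} (h : z n = false) (j : ℕ) :
    openAt z (n + 1) j = openAt z n (j + 1) := by
  unfold openAt
  congr 1
  ext l
  have := height_succ_of_false h
  constructor <;> rintro ⟨h1, h2⟩
  · refine ⟨?_, by push_cast; omega⟩
    rcases (show l < n ∨ l = n by omega) with h3 | rfl
    · exact h3
    · omega
  · push_cast at h2
    exact ⟨by omega, by omega⟩

theorem openAt_zero_of_false {z : ℤ → Bool} {n : ℤ} (h : z n = false) :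
    openAt z n 0 = partner z n := by
  unfold openAt partner
  congr 1
  ext l
  have := height_succ_of_false h
  constructor <;> rintro ⟨h1, h2⟩ <;> refine ⟨h1, ?_⟩
  · push_cast at h2; omega
  · push_cast; omega

theorem factorWord_succ {A : Type*} (x : ℤ → A) (r : ℤ) (n : ℕ) :
    factorWord x r (n + 1) = factorWord x r n ++ [x (r + n)] := by
  rw [factorWord, List.ofFn_succ_last]
  simp [factorWord]

theorem colourMap_mem {m : ℕ} (p : (ℤ → Bool) × (ℤ → Fin m)) : colourMap m p ∈ dyckShift m := by
  intro r n
  -- The surviving stack lists the colours of the brackets open at time `r`; reading `n` letters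
  -- turns it into the corresponding stack at time `r + n`.
  refine mem_dyckLanguage_of_wordAct (s := some fun j => p.2 (onesIndex p.1 (openAt p.1 r j))) ?_
  suffices h : wordAct (factorWord (colourMap m p) r n)
      (some fun j => p.2 (onesIndex p.1 (openAt p.1 r j))) =
      some fun j => p.2 (onesIndex p.1 (openAt p.1 (r + n) j)) by rw [h]; simp
  induction n with
  | zero => simp [factorWord, wordAct]
  | succ n ih =>
    rw [factorWord_succ, wordAct_append, ih, Nat.cast_succ, ← add_assoc]
    cases h : p.1 (r + n)
    · have : colourMap m p (r + n) =
          DyckLetter.beta (p.2 (onesIndex p.1 (partner p.1 (r + n)))) := by simp [colourMap, h]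
      rw [this]
      simp only [wordAct, List.foldl_cons, List.foldl_nil, DyckLetter.act, Option.bind_some,
        openAt_zero_of_false h, if_true, openAt_succ_of_false h]
    · have : colourMap m p (r + n) = DyckLetter.alpha (p.2 (onesIndex p.1 (r + n))) := by
        simp [colourMap, h]
      rw [this]
      simp only [wordAct, List.foldl_cons, List.foldl_nil, DyckLetter.act, Option.map_some]
      congr 1
      funext j
      cases j with
      | zero => simp [openAt_succ_of_true_zero h]
      | succ j => simp only [openAt_succ_of_true_succ h]

/-! ### Admissible sequences are consistent -/

/-- The class of a word in the Dyck monoid. -/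
def wordClass {m : ℕ} (w : List (DyckLetter m)) : (dyckCon m).Quotient :=
  (((FreeMonoid.ofList w : FreeMonoid (DyckLetter m)) : FreeDyck m) : (dyckCon m).Quotient)

theorem wordClass_append {m : ℕ} (v w : List (DyckLetter m)) :
    wordClass (v ++ w) = wordClass v * wordClass w := rfl

theorem mem_dyckLanguage_iff {m : ℕ} {w : List (DyckLetter m)} :
    w ∈ dyckLanguage m ↔ wordClass w ≠ ((0 : FreeDyck m) : (dyckCon m).Quotient) :=
  not_congr (Con.eq _).symm

theorem zero_mul_wordClass {m : ℕ} (w : List (DyckLetter m)) :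
    ((0 : FreeDyck m) : (dyckCon m).Quotient) * wordClass w = ((0 : FreeDyck m) :) := by
  change ((0 * _ : FreeDyck m) : (dyckCon m).Quotient) = _
  rw [zero_mul]

theorem mul_zero_wordClass {m : ℕ} (w : List (DyckLetter m)) :
    wordClass w * ((0 : FreeDyck m) : (dyckCon m).Quotient) = ((0 : FreeDyck m) :) := by
  change ((_ * 0 : FreeDyck m) : (dyckCon m).Quotient) = _
  rw [mul_zero]

theorem wordClass_alpha_beta {m : ℕ} (i j : Fin m) :
    wordClass [DyckLetter.alpha i] * wordClass [DyckLetter.beta j] =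
      if i = j then 1 else ((0 : FreeDyck m) : (dyckCon m).Quotient) := by
  split_ifs with h
  · subst h
    exact (Con.eq _).2 (ConGen.Rel.of _ _ (DyckRel.matched i))
  · exact (Con.eq _).2 (ConGen.Rel.of _ _ (DyckRel.mismatched i j h))

/-- The word `α_{c(d-1)} ⋯ α_{c(0)}` which pushes a stack. -/
def pushWord {m : ℕ} (c : ℕ → Fin m) (d : ℕ) : List (DyckLetter m) :=
  ((List.range d).map fun j => DyckLetter.alpha (c j)).reverse

theorem pushWord_succ {m : ℕ} (c : ℕ → Fin m) (d : ℕ) :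
    pushWord c (d + 1) = pushWord (fun j => c (j + 1)) d ++ [DyckLetter.alpha (c 0)] := by
  unfold pushWord
  rw [List.range_succ_eq_map]
  simp [Function.comp_def]

/-- As long as the walk stays above its starting height, cancelling matched pairs either reaches
zero or leaves exactly the opening letters not yet closed, innermost last. -/
theorem wordClass_factorWord_excursion {m : ℕ} (y : ℤ → DyckLetter m) (l : ℤ) (k : ℕ)
    (h : ∀ i, l < i → i ≤ l + k → height (shape y) l < height (shape y) i) :
    wordClass (factorWord y l k) = ((0 : FreeDyck m) :) ∨
      ∃ d : ℕ, (d : ℤ) = height (shape y) (l + k) - height (shape y) l ∧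
        wordClass (factorWord y l k) =
          wordClass (pushWord (fun j => (y (openAt (shape y) (l + k) j)).colour) d) := by
  induction k with
  | zero => exact Or.inr ⟨0, by simp, by simp [factorWord, pushWord]⟩
  | succ k ih =>
    rw [factorWord_succ, wordClass_append, Nat.cast_succ, ← add_assoc]
    rcases ih fun i h1 h2 => h i h1 (by push_cast; omega) with ih | ⟨d, hd, ih⟩
    · exact Or.inl (by rw [ih, zero_mul_wordClass])
    · rw [ih]
      cases hz : shape y (l + k)
      · have hs := height_succ_of_false hz
        have h1 := h (l + k + 1) (by omega) (by push_cast; omega)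
        -- Some bracket is still open, since the walk remains above its start even after closing
        -- one.
        obtain ⟨d, rfl⟩ : ∃ e, d = e + 1 := ⟨d - 1, by omega⟩
        rw [pushWord_succ, wordClass_append, mul_assoc, DyckLetter.eq_beta (s := y (l + k)) hz,
          wordClass_alpha_beta]
        split_ifs
        · refine Or.inr ⟨d, by push_cast at hd; omega, ?_⟩
          rw [mul_one]
          simp only [openAt_succ_of_false hz]
        · exact Or.inl (mul_zero_wordClass _)
      · have hs := height_succ_of_true hz
        refine Or.inr ⟨d + 1, by push_cast; omega, ?_⟩
        rw [pushWord_succ, wordClass_append]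
        simp only [openAt_succ_of_true_succ hz, openAt_succ_of_true_zero hz]
        rw [← DyckLetter.eq_alpha (s := y (l + k)) hz]

/-- Just before the closing letter `β_j`, the excursion has been reduced to the single letter `α_i`
at `l`; the product `α_i β_j` is nonzero only if `i = j`. -/
theorem consistent_of_mem {m : ℕ} {y : ℤ → DyckLetter m} (hy : y ∈ dyckShift m) (r s : ℤ) :
    Consistent y r s := by
  intro l n _ _ hm
  obtain ⟨k, hk⟩ : ∃ k : ℕ, n = l + k := ⟨(n - l).toNat, by have := hm.lt; omega⟩
  have hne := mem_dyckLanguage_iff.1 (hy l (k + 1))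
  rw [factorWord_succ, wordClass_append, ← hk] at hne
  have he : ∀ i, l < i → i ≤ l + k → height (shape y) l < height (shape y) i := fun i h1 h2 => by
    rw [hm.height_eq]; exact hm.lt_height h1 (by omega)
  rcases wordClass_factorWord_excursion y l k he with h | ⟨d, hd, h⟩
  · rw [h, zero_mul_wordClass] at hne
    exact absurd rfl hne
  · have h1 := hm.height_eq
    rw [height_succ_of_false hm.closes] at h1
    obtain rfl : d = 1 := by rw [← hk] at hd; omega
    rw [h, pushWord_succ, wordClass_append, mul_assoc, DyckLetter.eq_beta (s := y n) hm.closes,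
      ← hk, openAt_zero_of_false hm.closes, hm.partner_eq, wordClass_alpha_beta] at hne
    split_ifs at hne with hc
    · exact hc
    · exact absurd (mul_zero_wordClass _) hne

/-! ### A symmetric walk is unbounded below -/

-- The partial sums form a martingale with bounded increments. Almost surely, bounded below implies
-- bounded above, hence convergent, which is impossible when all increments have modulus 1.
open ProbabilityTheory in
theorem ae_not_bddBelow_sum {Ω : Type*} [MeasurableSpace Ω] {μ : Measure Ω}
    [IsProbabilityMeasure μ] {X : ℕ → Ω → ℝ} (hX : ∀ i, Measurable (X i)) (hi : iIndepFun X μ)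
    (h1 : ∀ i ω, |X i ω| = 1) (h0 : ∀ i, ∫ ω, X i ω ∂μ = 0) :
    ∀ᵐ ω ∂μ, ¬ BddBelow (Set.range fun n => ∑ i ∈ Finset.range (n + 1), X i ω) := by
  have hs : ∀ i, StronglyMeasurable (X i) := fun i => (hX i).stronglyMeasurable
  have hint : ∀ i, Integrable (X i) μ := fun i =>
    Integrable.of_bound (hs i).aestronglyMeasurable 1 (Eventually.of_forall fun ω => (h1 i ω).le)
  set S : ℕ → Ω → ℝ := fun n ω => ∑ i ∈ Finset.range (n + 1), X i ω with hS
  have hSe : ∀ n, S n = ∑ i ∈ Finset.range (n + 1), X i := fun n => by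
    funext ω; simp [hS, Finset.sum_apply]
  have hstep : ∀ n ω, S (n + 1) ω - S n ω = X (n + 1) ω := fun n ω => by
    simp only [hS]; rw [Finset.sum_range_succ _ (n + 1)]; ring
  have hmart : Martingale S (Filtration.natural X hs) μ := by
    refine martingale_of_condExp_sub_eq_zero_nat (fun n => ?_) (fun n => ?_) fun n => ?_
    · rw [hSe]
      refine Finset.stronglyMeasurable_sum _ fun i hin => ?_
      exact (Filtration.stronglyAdapted_natural hs i).mono
        ((Filtration.natural X hs).mono (by simpa [Nat.lt_succ_iff] using hin))
    · rw [hSe]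
      exact integrable_finsetSum' _ fun i _ => hint i
    · have : S (n + 1) - S n = X (n + 1) := funext fun ω => hstep n ω
      rw [this]
      refine (iIndepFun.condExp_natural_ae_eq_of_lt hs hi n.lt_succ_self).trans ?_
      rw [h0]
      rfl
  have hbd : ∀ᵐ ω ∂μ, ∀ i, |S (i + 1) ω - S i ω| ≤ ((1 : NNReal) : ℝ) :=
    Eventually.of_forall fun ω i => by rw [hstep, h1]; simp
  filter_upwards [hmart.bddAbove_range_iff_bddBelow_range hbd,
    hmart.submartingale.bddAbove_iff_exists_tendsto hbd] with ω ha hb hc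
  obtain ⟨c, hc⟩ := hb.1 (ha.2 hc)
  have hd : Tendsto (fun n => |S (n + 1) ω - S n ω|) atTop (nhds |c - c|) :=
    (((tendsto_add_atTop_iff_nat 1).2 hc).sub hc).abs
  simp only [hstep, h1, sub_self, abs_zero] at hd
  exact one_ne_zero (tendsto_nhds_unique tendsto_const_nhds hd)

/-! ### The symmetric product measure -/

theorem uniformOn_univ_singleton {A : Type} [MeasurableSpace A] [MeasurableSingletonClass A]
    [Fintype A] (a : A) :
    ProbabilityTheory.uniformOn (Set.univ : Set A) {a} = (Fintype.card A : ENNReal)⁻¹ := by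
  rw [ProbabilityTheory.uniformOn_univ]
  simp

section SymmetricProduct

variable {A : Type} [MeasurableSpace A] [MeasurableSingletonClass A] [Fintype A] [Nonempty A]

instance : IsProbabilityMeasure (ProbabilityTheory.uniformOn (Set.univ : Set A)) :=
  ProbabilityTheory.isProbabilityMeasure_uniformOn Set.finite_univ Set.univ_nonempty

instance : IsProbabilityMeasure (symmetricProduct A) := by
  unfold symmetricProduct; infer_instance

theorem symmetricProduct_agree {ι : Type*} (s : Finset ι) (t : ι → ℤ) (ht : Set.InjOn t s)
    (f : ι → A) :
    symmetricProduct A {a | ∀ i ∈ s, a (t i) = f i} = ((Fintype.card A : ENNReal)⁻¹) ^ s.card := by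
  classical
  obtain ⟨g, hg⟩ : ∃ g : ℤ → A, ∀ i ∈ s, g (t i) = f i := by
    have hex : ∀ n : ℤ, ∃ b : A, ∀ i ∈ s, t i = n → f i = b := by
      intro n
      by_cases h : ∃ i ∈ s, t i = n
      · obtain ⟨i, hi, rfl⟩ := h
        exact ⟨f i, fun j hj hji => by rw [ht hj hi hji]⟩
      · push Not at h
        exact ⟨Classical.arbitrary A, fun i hi hin => absurd hin (h i hi)⟩
    choose g hg using hex
    exact ⟨g, fun i hi => (hg _ i hi rfl).symm⟩
  have : {a : ℤ → A | ∀ i ∈ s, a (t i) = f i} =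
      Set.pi (s.image t : Finset ℤ) fun n => ({g n} : Set A) := by
    ext a
    simp only [Set.mem_ofPred_eq, Set.mem_pi, Finset.coe_image, Set.mem_image, Set.mem_singleton_iff]
    constructor
    · rintro h _ ⟨i, hi, rfl⟩
      rw [h i hi, hg i hi]
    · intro h i hi
      rw [h (t i) ⟨i, hi, rfl⟩, hg i hi]
  rw [this, symmetricProduct, Measure.infinitePi_pi _ fun _ _ => measurableSet_singleton _]
  simp only [uniformOn_univ_singleton, Finset.prod_const, Finset.card_image_of_injOn ht]

/-- Along distinct coordinates, a random sequence is almost surely not periodic. -/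
theorem symmetricProduct_periodic_eq_zero (hA : 2 ≤ Fintype.card A) (t : ℕ → ℤ)
    (ht : Function.Injective t) (e : ℕ) (he : 0 < e) :
    symmetricProduct A {a | ∀ h, a (t (h + e)) = a (t h)} = 0 := by
  -- A periodic sequence is determined by its first `e` values `f`. For each of the finitely many
  -- `f`, agreement at `N` places has probability `|A|^(-N)`, which tends to 0.
  have hsub : {a : ℤ → A | ∀ h, a (t (h + e)) = a (t h)} ⊆
      ⋃ f : Fin e → A, ⋂ N : ℕ, {a | ∀ i ∈ Finset.range N, a (t i) =
        f ⟨i % e, Nat.mod_lt _ he⟩} := by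
    intro a ha
    refine Set.mem_iUnion.2 ⟨fun i => a (t i), Set.mem_iInter.2 fun N i _ => ?_⟩
    have key : ∀ q r, a (t (r + e * q)) = a (t r) := by
      intro q r
      induction q with
      | zero => simp
      | succ q ih => rw [mul_add, mul_one, ← add_assoc, ha, ih]
    change a (t i) = a (t (i % e))
    rw [← key (i / e) (i % e), Nat.mod_add_div]
  refine measure_mono_null hsub (measure_iUnion_null fun f => ?_)
  have hlt : (Fintype.card A : ENNReal)⁻¹ < 1 := by
    rw [ENNReal.inv_lt_one]; exact_mod_cast hA
  have hlim := ENNReal.tendsto_pow_atTop_nhds_zero_of_lt_one hlt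
  refine le_antisymm (ge_of_tendsto' hlim fun N => ?_) bot_le
  refine (measure_mono (Set.iInter_subset _ N)).trans_eq ?_
  rw [symmetricProduct_agree _ _ ht.injOn, Finset.card_range]

end SymmetricProduct

-- The injection `e` and the signs `σ` are arbitrary so that both half-lines are covered: to the
-- left, positions are `-1 - i` and the signs are reversed.
open ProbabilityTheory in
theorem ae_not_bddBelow_bool (e : ℕ → ℤ) (he : Function.Injective e) (σ : Bool → ℝ)
    (h1 : ∀ b, |σ b| = 1) (h0 : σ true + σ false = 0) :
    ∀ᵐ z ∂symmetricProduct Bool,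
      ¬ BddBelow (Set.range fun n => ∑ i ∈ Finset.range (n + 1), σ (z (e i))) := by
  have hσ : Measurable σ := measurable_of_countable σ
  have hi : iIndepFun (fun (i : ℕ) (z : ℤ → Bool) => σ (z (e i))) (symmetricProduct Bool) :=
    iIndepFun.precomp he (f := fun (i : ℤ) (z : ℤ → Bool) => σ (z i))
      (iIndepFun_infinitePi (X := fun (_ : ℤ) b => σ b) fun _ => hσ)
  have h0' : ∀ i, ∫ z, σ (z (e i)) ∂symmetricProduct Bool = 0 := fun i => by
    have hm : (symmetricProduct Bool).map (fun z => z (e i)) = uniformOn Set.univ :=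
      Measure.infinitePi_map_eval _ _
    have := integral_map (μ := symmetricProduct Bool) (φ := fun z => z (e i)) (f := σ)
      (measurable_pi_apply _).aemeasurable hσ.aestronglyMeasurable
    rw [← this, hm, integral_fintype (.of_finite)]
    simp only [measureReal_def, uniformOn_univ_singleton]
    simp [← mul_add, h0]
  have hm : ∀ i : ℕ, Measurable fun z : ℤ → Bool => σ (z (e i)) := fun i => by fun_prop
  have key := @ae_not_bddBelow_sum (ℤ → Bool) _ (symmetricProduct Bool)
  exact key (X := fun i z => σ (z (e i))) hm hi (fun _ _ => h1 _) h0'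

theorem ae_mem_unboundedBelow : ∀ᵐ z ∂symmetricProduct Bool, z ∈ unboundedBelow := by
  have hr : ∀ (z : ℤ → Bool) (n : ℕ),
      ∑ i ∈ Finset.range n, (if z (i : ℤ) then (1 : ℝ) else -1) = (height z n : ℝ) := by
    intro z n
    induction n with
    | zero => simp [height_zero]
    | succ n ih =>
      rw [Finset.sum_range_succ, ih, Nat.cast_succ, height_succ]
      split_ifs <;> push_cast <;> ring
  have hl : ∀ (z : ℤ → Bool) (n : ℕ),
      ∑ i ∈ Finset.range n, (if z (-1 - (i : ℤ)) then (-1 : ℝ) else 1) = (height z (-n) : ℝ) := by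
    intro z n
    induction n with
    | zero => simp [height_zero]
    | succ n ih =>
      have := height_succ z (-1 - n)
      rw [show (-1 - (n : ℤ) + 1) = -n by ring] at this
      rw [Finset.sum_range_succ, ih, this, show -((n + 1 : ℕ) : ℤ) = -1 - n by push_cast; ring]
      split_ifs <;> push_cast <;> ring
  filter_upwards [ae_not_bddBelow_bool (fun i => i) Nat.cast_injective
      (fun b => if b then 1 else -1) (by simp) (by simp),
    ae_not_bddBelow_bool (fun i => -1 - i) (fun i j h => by simpa using h)
      (fun b => if b then -1 else 1) (by simp) (by simp)] with z h1 h2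
  simp only [hr, hl] at h1 h2
  constructor <;> intro c <;> by_contra hc <;> push Not at hc
  · refine h1 ⟨c, ?_⟩
    rintro _ ⟨n, rfl⟩
    change (c : ℝ) ≤ (height z _ : ℝ)
    exact_mod_cast hc (n + 1 : ℕ) (by positivity)
  · refine h2 ⟨c, ?_⟩
    rintro _ ⟨n, rfl⟩
    change (c : ℝ) ≤ (height z _ : ℝ)
    exact_mod_cast hc (-(n + 1 : ℕ)) (by push_cast; omega)

/-! ### Measurability of the colouring map -/

theorem measurable_height (i : ℤ) : Measurable fun z : ℤ → Bool => height z i := by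
  have h : ∀ (j : ℤ) (f : Bool → ℤ), Measurable fun z : ℤ → Bool => f (z j) := fun j f =>
    (measurable_of_countable f).comp (measurable_pi_apply j)
  unfold height
  split_ifs
  · exact Finset.measurable_sum _ fun j _ => h j fun b => if b then 1 else -1
  · exact Finset.measurable_sum _ fun j _ => h j fun b => if b then -1 else 1

theorem measurable_onesIndex (i : ℤ) : Measurable fun z : ℤ → Bool => onesIndex z i := by
  have h : ∀ j : ℤ, Measurable fun z : ℤ → Bool => (if z j then 1 else 0 : ℤ) := fun j =>
    (measurable_of_countable fun b : Bool => (if b then 1 else 0 : ℤ)).comp (measurable_pi_apply j)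
  unfold onesIndex
  split_ifs
  · exact Finset.measurable_sum _ fun j _ => h j
  · exact (Finset.measurable_sum _ fun j _ => h j).neg

theorem measurable_sSup_int {Ω : Type*} [MeasurableSpace Ω] {s : Ω → Set ℤ}
    (hb : ∀ ω, BddAbove (s ω)) (hs : ∀ l, Measurable fun ω => l ∈ s ω) :
    Measurable fun ω => sSup (s ω) := by
  refine measurable_to_countable' fun l => ?_
  -- The supremum is `l` if `l` is the maximum, or if the set is empty and `l` is the default value
  -- 0; both are countable conditions.
  have : (fun ω => sSup (s ω)) ⁻¹' {l} =
      {ω | (l ∈ s ω ∧ ∀ i, i ∈ s ω → i ≤ l) ∨ ((∀ i, ¬ i ∈ s ω) ∧ l = 0)} := by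
    ext ω
    simp only [Set.mem_preimage, Set.mem_singleton_iff, Set.mem_ofPred_eq]
    rcases (s ω).eq_empty_or_nonempty with h | h
    · simp [h, eq_comm]
    · have hg := isGreatest_sSup_int h (hb ω)
      constructor
      · rintro rfl
        exact Or.inl ⟨hg.1, fun i hi => hg.2 hi⟩
      · rintro (⟨h1, h2⟩ | ⟨h1, _⟩)
        · exact hg.unique ⟨h1, fun i hi => h2 i hi⟩
        · exact absurd h.choose_spec (h1 _)
  rw [this]
  exact measurableSet_setOfPred.2 (((hs l).and (.forall fun i => (hs i).imp measurable_const)).or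
    ((Measurable.forall fun i => (hs i).not).and measurable_const))

theorem measurable_partner (n : ℤ) : Measurable fun z : ℤ → Bool => partner z n :=
  measurable_sSup_int (fun _ => ⟨n, fun _ hl => hl.1.le⟩) fun l => measurable_const.and
    (measurableSet_setOfPred.1 (measurableSet_le (measurable_height l) (measurable_height (n + 1))))

theorem measurable_openAt (n : ℤ) (j : ℕ) : Measurable fun z : ℤ → Bool => openAt z n j :=
  measurable_sSup_int (fun _ => ⟨n, fun _ hl => hl.1.le⟩) fun l => measurable_const.and
    (measurableSet_setOfPred.1 (measurableSet_lt (measurable_height l)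
      ((measurable_height n).sub measurable_const)))

theorem measurable_colourIndex (n : ℤ) : Measurable fun z : ℤ → Bool => colourIndex z n := by
  have h1 : Measurable fun q : ℤ × (ℤ → Bool) => onesIndex q.2 q.1 :=
    measurable_from_prod_countable_right fun i => measurable_onesIndex i
  have h2 : Measurable fun z : ℤ → Bool => opening z n :=
    Measurable.ite (measurableSet_eq_fun (measurable_pi_apply n) measurable_const)
      measurable_const (measurable_partner n)
  exact h1.comp (h2.prodMk measurable_id)

instance (m : ℕ) : DiscreteMeasurableSpace (DyckLetter m) := ⟨fun _ => trivial⟩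

theorem DyckLetter.finite (m : ℕ) : Finite (DyckLetter m) := by
  refine Finite.of_injective (fun s : DyckLetter m => (s.isAlpha, s.colour)) fun s t h => ?_
  exact DyckLetter.ext' (congrArg Prod.fst h) (congrArg Prod.snd h)

instance (m : ℕ) : Finite (DyckLetter m) := DyckLetter.finite m

theorem measurable_colourMap (m : ℕ) : Measurable (colourMap m) := by
  refine measurable_pi_iff.2 fun n => ?_
  have h1 : Measurable fun q : ℤ × (ℤ → Fin m) => q.2 q.1 :=
    measurable_from_prod_countable_right fun i => measurable_pi_apply i
  have h2 : Measurable fun p : (ℤ → Bool) × (ℤ → Fin m) => p.2 (colourIndex p.1 n) :=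
    h1.comp (((measurable_colourIndex n).comp measurable_fst).prodMk measurable_snd)
  have h3 : Measurable fun p : (ℤ → Bool) × (ℤ → Fin m) => p.1 n :=
    (measurable_pi_apply n).comp measurable_fst
  have h4 : (fun p => colourMap m p n) = fun p : (ℤ → Bool) × (ℤ → Fin m) =>
      (fun q : Bool × Fin m => if q.1 then DyckLetter.alpha q.2 else DyckLetter.beta q.2)
        (p.1 n, p.2 (colourIndex p.1 n)) := by
    funext p
    cases h : p.1 n <;> simp [colourMap, h, colourIndex, opening]
  rw [h4]
  exact (measurable_of_countable fun q : Bool × Fin m =>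
    if q.1 then DyckLetter.alpha q.2 else DyckLetter.beta q.2).comp (h3.prodMk h2)

theorem measurableSet_unboundedBelow : MeasurableSet unboundedBelow := by
  have h : ∀ c i, MeasurableSet {z : ℤ → Bool | height z i < c} := fun c i =>
    measurableSet_lt (measurable_height _) measurable_const
  simp only [measurableSet_setOfPred] at h
  exact measurableSet_setOfPred.2 ((Measurable.forall fun c => .exists fun n =>
    measurable_const.and (h c n)).and (.forall fun c => .exists fun n =>
      measurable_const.and (h c n)))

/-! ### The law of the colouring map and its values on cylinders -/

/-- The measure `(μ₁ × μ₂) ∘ F⁻¹` on the full shift. -/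
def dyckLaw (m : ℕ) : Measure (ℤ → DyckLetter m) :=
  (((symmetricProduct Bool).prod (symmetricProduct (Fin m))).restrict
      (unboundedBelow ×ˢ Set.univ)).map (colourMap m)

variable {m : ℕ}

theorem dyckLaw_eq_map [NeZero m] :
    dyckLaw m = ((symmetricProduct Bool).prod (symmetricProduct (Fin m))).map (colourMap m) := by
  unfold dyckLaw
  rw [Measure.restrict_eq_self_of_ae_mem]
  have := (Measure.quasiMeasurePreserving_fst (μ := symmetricProduct Bool)
    (ν := symmetricProduct (Fin m))).ae ae_mem_unboundedBelow
  filter_upwards [this] with p hp using ⟨hp, trivial⟩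

instance [NeZero m] : IsProbabilityMeasure (dyckLaw m) := by
  rw [dyckLaw_eq_map]
  exact Measure.isProbabilityMeasure_map (measurable_colourMap m).aemeasurable

/-- The cylinder of the sequences which agree with `y` on `[r, s)`. -/
def cyl {A : Type*} (y : ℤ → A) (r s : ℤ) : Set (ℤ → A) := {x | ∀ n, r ≤ n → n < s → x n = y n}

theorem measurableSet_cyl {A : Type*} [MeasurableSpace A] [MeasurableSingletonClass A]
    (y : ℤ → A) (r s : ℤ) : MeasurableSet (cyl y r s) := by
  have h : ∀ n, Measurable fun x : ℤ → A => x n = y n := fun n => measurableSet_setOfPred.1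
    (measurable_pi_apply n (measurableSet_singleton (y n)) : MeasurableSet {x : ℤ → A | x n ∈ _})
  exact measurableSet_setOfPred.2 (.forall fun n => measurable_const.imp (measurable_const.imp (h n)))

theorem Consistent.congr {x y : ℤ → DyckLetter m} {r s : ℤ} (h : Consistent x r s)
    (hxy : ∀ n, r ≤ n → n < s → x n = y n) : Consistent y r s := by
  intro l n hl hn hm
  have := hm.lt
  rw [← hxy l hl (by omega), ← hxy n (by omega) hn]
  refine h l n hl hn (hm.congr fun i h1 h2 => ?_)
  simp only [shape]
  rw [hxy i (by omega) (by omega)]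

theorem dyckLaw_cyl_of_not_consistent [NeZero m] {y : ℤ → DyckLetter m} {r s : ℤ}
    (h : ¬ Consistent y r s) : dyckLaw m (cyl y r s) = 0 := by
  rw [dyckLaw_eq_map, Measure.map_apply (measurable_colourMap m) (measurableSet_cyl _ _ _)]
  have : colourMap m ⁻¹' cyl y r s = ∅ := Set.eq_empty_of_forall_notMem fun p hp =>
    h ((consistent_colourMap p r s).congr hp)
  rw [this, measure_empty]

/-- A position that is not fresh inherits its colour from an opening in the window, and consistency
of `y` makes that the required colour. Only fresh positions impose conditions. -/
theorem colourMap_mem_cyl_iff {y : ℤ → DyckLetter m} {r s : ℤ} (h : Consistent y r s)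
    {z : ℤ → Bool} (hz : ∀ n, r ≤ n → n < s → z n = shape y n) (a : ℤ → Fin m) :
    colourMap m (z, a) ∈ cyl y r s ↔
      ∀ n ∈ freshSet z r s, a (colourIndex z n) = (y n).colour := by
  constructor
  · intro ha n hn
    rw [mem_freshSet] at hn
    rw [← ha n hn.1.1 hn.1.2, colour_colourMap]
  · intro ha n h1 h2
    refine DyckLetter.ext' ?_ ?_
    · exact (congrFun (shape_colourMap (z, a)) n).trans (hz n h1 h2)
    · rw [colour_colourMap]
      by_cases hf : Fresh z r n
      · exact ha n (mem_freshSet.2 ⟨⟨h1, h2⟩, hf⟩)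
      · obtain ⟨l, hl, hm⟩ := exists_isMatch_of_not_fresh hf
        have := hm.lt
        rw [colourIndex_of_isMatch hm,
          ← h l n hl h2 (hm.congr fun i h3 h4 => hz i (by omega) (by omega))]
        exact ha l (mem_freshSet.2 ⟨⟨hl, by omega⟩, Or.inl hm.opens⟩)

/-- The brackets over the window have the right shape with probability `2^(-N)`. Given any such `z`,
the conditions on the colours concern distinct coordinates of `a`, one for each fresh position. -/
theorem dyckLaw_cyl [NeZero m] {y : ℤ → DyckLetter m} {r s : ℤ} (h : Consistent y r s) :
    dyckLaw m (cyl y r s) =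
      (2⁻¹ : ENNReal) ^ (s - r).toNat * (m : ENNReal)⁻¹ ^ (freshSet (shape y) r s).card := by
  have hme := measurable_colourMap m (measurableSet_cyl y r s)
  rw [dyckLaw_eq_map, Measure.map_apply (measurable_colourMap m) (measurableSet_cyl _ _ _),
    Measure.prod_apply hme]
  have hE := measurableSet_cyl (shape y) r s
  have key : ∀ᵐ z ∂symmetricProduct Bool,
      symmetricProduct (Fin m) (Prod.mk z ⁻¹' (colourMap m ⁻¹' cyl y r s)) =
        (cyl (shape y) r s).indicator
          (fun _ => (m : ENNReal)⁻¹ ^ (freshSet (shape y) r s).card) z := by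
    filter_upwards [ae_mem_unboundedBelow] with z hz
    by_cases hzy : z ∈ cyl (shape y) r s
    · rw [Set.indicator_of_mem hzy, ← freshSet_congr hzy]
      have : Prod.mk z ⁻¹' (colourMap m ⁻¹' cyl y r s) =
          {a | ∀ n ∈ freshSet z r s, a (colourIndex z n) = (y n).colour} :=
        Set.ext fun a => colourMap_mem_cyl_iff h hzy a
      rw [this, symmetricProduct_agree _ _ (colourIndex_injOn_fresh hz r s), Fintype.card_fin]
    · rw [Set.indicator_of_notMem hzy]
      have : Prod.mk z ⁻¹' (colourMap m ⁻¹' cyl y r s) = ∅ :=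
        Set.eq_empty_of_forall_notMem fun a ha => hzy fun n h1 h2 =>
          (congrFun (shape_colourMap (z, a)) n).symm.trans
            (congrArg DyckLetter.isAlpha (ha n h1 h2))
      rw [this, measure_empty]
  rw [lintegral_congr_ae key, lintegral_indicator_const hE, mul_comm]
  congr 1
  have : cyl (shape y) r s = {z | ∀ n ∈ Finset.Ico r s, z n = shape y n} := by
    ext z; simp [cyl]
  rw [this, symmetricProduct_agree _ (fun n => n) Function.injective_id.injOn]
  simp

/-! ### Measures that agree on small cylinders -/

section Cylinders

variable {A : Type*}

/-- The union of the cylinders over `[-k, k]` that meet `B`. -/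
def cylHull (B : Set (ℤ → A)) (k : ℕ) : Set (ℤ → A) := {y | ∃ x ∈ B, y ∈ cyl x (-k) (k + 1)}

theorem cylHull_antitone (B : Set (ℤ → A)) : Antitone (cylHull B) := by
  rintro k l hkl y ⟨x, hx, hy⟩
  exact ⟨x, hx, fun n h1 h2 => hy n (by omega) (by omega)⟩

/-- The restriction of a sequence to `[-k, k]`. -/
def window (k : ℕ) (x : ℤ → A) : Set.Ico (-(k : ℤ)) (k + 1) → A := fun n => x n

theorem preimage_window_singleton (k : ℕ) (x : ℤ → A) :
    window k ⁻¹' {window k x} = cyl x (-k) (k + 1) := by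
  ext y
  simp only [Set.mem_preimage, Set.mem_singleton_iff, window, funext_iff, Subtype.forall, cyl,
    Set.mem_Ico, and_imp]
  rfl

theorem cylHull_eq_preimage (B : Set (ℤ → A)) (k : ℕ) :
    cylHull B k = window k ⁻¹' (window k '' B) := by
  ext y
  constructor
  · rintro ⟨x, hx, hy⟩
    rw [← preimage_window_singleton] at hy
    exact ⟨x, hx, hy.symm⟩
  · rintro ⟨x, hx, hy⟩
    refine ⟨x, hx, ?_⟩
    rw [← preimage_window_singleton]
    exact hy.symm

theorem iInter_cylHull [TopologicalSpace A] {B : Set (ℤ → A)} (hB : IsClosed B) : ⋂ k, cylHull B k = B := by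
  refine Set.Subset.antisymm (fun y hy => ?_) fun x hx => Set.mem_iInter.2 fun k =>
    ⟨x, hx, fun _ _ _ => rfl⟩
  rw [Set.mem_iInter] at hy
  choose x hx hxy using hy
  refine hB.mem_of_tendsto (b := atTop) (f := x) ?_ (Eventually.of_forall hx)
  refine tendsto_pi_nhds.2 fun n => ?_
  refine tendsto_const_nhds.congr' ?_
  filter_upwards [eventually_ge_atTop n.natAbs] with k hk
  exact hxy k n (by omega) (by omega)

theorem measurable_window [MeasurableSpace A] (k : ℕ) : Measurable (window k : (ℤ → A) → _) :=
  measurable_pi_lambda _ fun _ => measurable_pi_apply _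

variable [Finite A] [TopologicalSpace A] [DiscreteTopology A] [MeasurableSpace A] [BorelSpace A]

theorem measurableSet_cylHull (B : Set (ℤ → A)) (k : ℕ) : MeasurableSet (cylHull B k) := by
  rw [cylHull_eq_preimage]
  exact measurable_window k (Set.toFinite _).measurableSet

theorem measure_cylHull_eq {μ ν : Measure (ℤ → A)} {B : Set (ℤ → A)} {k : ℕ}
    (h : ∀ x ∈ B, μ (cyl x (-k) (k + 1)) = ν (cyl x (-k) (k + 1))) :
    μ (cylHull B k) = ν (cylHull B k) := by
  have hW := Set.toFinite (window k '' B)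
  have hm : ∀ w ∈ hW.toFinset, MeasurableSet (window k ⁻¹' {w} : Set (ℤ → A)) := fun w _ =>
    measurable_window k (measurableSet_singleton w)
  rw [cylHull_eq_preimage, ← hW.coe_toFinset, ← sum_measure_preimage_singleton _ hm,
    ← sum_measure_preimage_singleton _ hm]
  refine Finset.sum_congr rfl fun w hw => ?_
  obtain ⟨x, hx, rfl⟩ := hW.mem_toFinset.1 hw
  rw [preimage_window_singleton, h x hx]

/-- Two finite measures agree on a Borel set if around each of its points they agree on all small
cylinders. -/
theorem measure_eq_of_eventually_cyl_eq {μ ν : Measure (ℤ → A)} [IsFiniteMeasure μ]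
    [IsFiniteMeasure ν] {B : Set (ℤ → A)} (hB : MeasurableSet B)
    (h : ∀ x ∈ B, ∀ᶠ k : ℕ in atTop, μ (cyl x (-k) (k + 1)) = ν (cyl x (-k) (k + 1))) :
    μ B = ν B := by
  -- closed sets around whose points the agreement starts uniformly
  have closed : ∀ (K : ℕ) (C : Set (ℤ → A)), IsClosed C →
      (∀ x ∈ C, ∀ k ≥ K, μ (cyl x (-k) (k + 1)) = ν (cyl x (-k) (k + 1))) → μ C = ν C := by
    intro K C hC hK
    have lim : ∀ (ρ : Measure (ℤ → A)) [IsFiniteMeasure ρ],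
        Tendsto (fun k => ρ (cylHull C k)) atTop (nhds (ρ C)) := fun ρ _ => by
      have := tendsto_measure_iInter_atTop (μ := ρ)
        (fun k => (measurableSet_cylHull C k).nullMeasurableSet) (cylHull_antitone C)
        ⟨0, measure_ne_top _ _⟩
      rwa [iInter_cylHull hC] at this
    refine tendsto_nhds_unique ((lim μ).congr' ?_) (lim ν)
    filter_upwards [eventually_ge_atTop K] with k hk
    exact measure_cylHull_eq fun x hx => hK x hx k hk
  -- Inner regularity extends the uniform case from closed to Borel sets.
  have unif : ∀ (K : ℕ) (C : Set (ℤ → A)), MeasurableSet C →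
      (∀ x ∈ C, ∀ k ≥ K, μ (cyl x (-k) (k + 1)) = ν (cyl x (-k) (k + 1))) → μ C = ν C := by
    intro K C hC hK
    rw [hC.measure_eq_iSup_isClosed_of_ne_top (measure_ne_top μ C),
      hC.measure_eq_iSup_isClosed_of_ne_top (measure_ne_top ν C)]
    refine iSup_congr fun D => iSup_congr fun hD => iSup_congr fun hDc => ?_
    exact closed K D hDc fun x hx => hK x (hD hx)
  -- the set of points around which the agreement starts at `K`
  set G : ℕ → Set (ℤ → A) := fun K =>
    {x | ∀ k ≥ K, μ (cyl x (-k) (k + 1)) = ν (cyl x (-k) (k + 1))} with hG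
  have hGm : ∀ K, MeasurableSet (G K) := by
    intro K
    have : G K = ⋂ k : ℕ, ⋂ _ : k ≥ K,
        window k ⁻¹' {w | μ (window k ⁻¹' {w}) = ν (window k ⁻¹' {w})} := by
      ext x
      simp only [hG, Set.mem_ofPred_eq, Set.mem_iInter, Set.mem_preimage,
        preimage_window_singleton]
    rw [this]
    exact .iInter fun k => .iInter fun _ => measurable_window k (Set.toFinite _).measurableSet
  have hmono : Monotone fun K => B ∩ G K := fun K L hKL x hx =>
    ⟨hx.1, fun k hk => hx.2 k (hKL.trans hk)⟩
  have hU : ⋃ K, B ∩ G K = B := by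
    rw [← Set.inter_iUnion]
    refine Set.inter_eq_left.2 fun x hx => ?_
    obtain ⟨K, hK⟩ := eventually_atTop.1 (h x hx)
    exact Set.mem_iUnion.2 ⟨K, hK⟩
  have lim : ∀ ρ : Measure (ℤ → A),
      Tendsto (fun k => ρ (B ∩ G k)) atTop (nhds (ρ B)) := fun ρ => by
    have := tendsto_measure_iUnion_atTop (μ := ρ) hmono
    rwa [hU] at this
  refine tendsto_nhds_unique ((lim μ).congr fun K => ?_) (lim ν)
  exact unif K _ (hB.inter (hGm K)) fun x hx => hx.2

end Cylinders

/-! ### The measure on the Dyck shift -/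

instance : DiscreteTopology (DyckLetter m) := ⟨rfl⟩

instance : BorelSpace (DyckLetter m) := ⟨(borel_eq_top_of_discrete).symm⟩

theorem measurableSet_dyckShift : MeasurableSet (dyckShift m) := by
  have h : ∀ (r : ℤ) (n : ℕ),
      MeasurableSet {x : ℤ → DyckLetter m | factorWord x r n ∈ dyckLanguage m} := fun r n => by
    have hf : Measurable fun (x : ℤ → DyckLetter m) (i : Fin n) => x (r + (i : ℕ)) :=
      measurable_pi_lambda _ fun _ => measurable_pi_apply _
    exact hf (Set.toFinite {w | List.ofFn w ∈ dyckLanguage m}).measurableSet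
  have : dyckShift m = ⋂ (r : ℤ) (n : ℕ), {x | factorWord x r n ∈ dyckLanguage m} := by
    ext x; simp [dyckShift]
  rw [this]
  exact .iInter fun r => .iInter fun n => h r n

theorem dyckLaw_ae_mem [NeZero m] : ∀ᵐ x ∂dyckLaw m, x ∈ dyckShift m := by
  rw [dyckLaw_eq_map]
  exact (ae_map_iff (p := (· ∈ dyckShift m)) (measurable_colourMap m).aemeasurable
    measurableSet_dyckShift).2 (Eventually.of_forall colourMap_mem)

theorem map_val_thirdMeasure [NeZero m] : (thirdMeasure m).map Subtype.val = dyckLaw m := by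
  change ((dyckLaw m).comap _).map _ = _
  rw [(MeasurableEmbedding.subtype_coe measurableSet_dyckShift).map_comap, Subtype.range_coe,
    Measure.restrict_eq_self_of_ae_mem dyckLaw_ae_mem]

theorem thirdMeasure_preimage_val [NeZero m] {B : Set (ℤ → DyckLetter m)} (hB : MeasurableSet B) :
    thirdMeasure m (Subtype.val ⁻¹' B) = dyckLaw m B := by
  rw [← map_val_thirdMeasure, Measure.map_apply measurable_subtype_coe hB]

instance [NeZero m] : IsProbabilityMeasure (thirdMeasure m) := ⟨by
  rw [← Set.preimage_univ (f := Subtype.val), thirdMeasure_preimage_val .univ, measure_univ]⟩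

/-! ### Shift invariance -/

theorem height_shift (z : ℤ → Bool) (c n : ℤ) :
    height (fun i => z (i + c)) n = height z (n + c) - height z c := by
  induction n using Int.induction_on with
  | zero => simp [height_zero]
  | succ n ih =>
    rw [height_succ, ih, show (n : ℤ) + 1 + c = n + c + 1 by ring, height_succ]
    ring
  | pred n ih =>
    have h1 := height_succ (fun i => z (i + c)) (-n - 1)
    have h2 := height_succ z (-n - 1 + c)
    rw [show -(n : ℤ) - 1 + 1 = -n by ring] at h1
    rw [show -(n : ℤ) - 1 + c + 1 = -n + c by ring] at h2
    omega

theorem isMatch_shift {z : ℤ → Bool} {c l n : ℤ} :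
    IsMatch (fun i => z (i + c)) l n ↔ IsMatch z (l + c) (n + c) := by
  constructor <;> rintro ⟨h1, h2, h3, h4⟩
  · simp only [height_shift] at h3 h4
    rw [show n + 1 + c = n + c + 1 by ring] at h3 h4
    refine ⟨by omega, h2, by omega, fun i h5 h6 => ?_⟩
    have := h4 (i - c) (by omega) (by omega)
    rw [sub_add_cancel] at this
    omega
  · refine ⟨by omega, h2, ?_, fun i h5 h6 => ?_⟩ <;>
      rw [height_shift, height_shift, show n + 1 + c = n + c + 1 by ring]
    · omega
    · have := h4 (i + c) (by omega) (by omega)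
      omega

theorem fresh_shift {z : ℤ → Bool} {c r n : ℤ} :
    Fresh (fun i => z (i + c)) r n ↔ Fresh z (r + c) (n + c) := by
  unfold Fresh
  refine or_congr_right ⟨fun h l h1 h2 => ?_, fun h l h1 h2 => ?_⟩
  · have := h (l - c) (by omega) (by omega)
    rw [height_shift, height_shift, sub_add_cancel, show n + 1 + c = n + c + 1 by ring] at this
    omega
  · have := h (l + c) (by omega) (by omega)
    rw [height_shift, height_shift, show n + 1 + c = n + c + 1 by ring]
    omega

theorem card_freshSet_shift (z : ℤ → Bool) (c r s : ℤ) :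
    (freshSet (fun i => z (i + c)) r s).card = (freshSet z (r + c) (s + c)).card := by
  refine Finset.card_nbij' (· + c) (· - c) (fun n hn => ?_) (fun n hn => ?_)
    (fun n _ => add_sub_cancel_right n c) fun n _ => sub_add_cancel n c
  · rw [Finset.mem_coe, mem_freshSet, fresh_shift] at hn
    exact mem_freshSet.2 ⟨by dsimp only; omega, hn.2⟩
  · rw [Finset.mem_coe, mem_freshSet] at hn
    refine mem_freshSet.2 ⟨by dsimp only; omega, ?_⟩
    rw [fresh_shift, sub_add_cancel]
    exact hn.2

theorem consistent_shift {y : ℤ → DyckLetter m} {c r s : ℤ} :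
    Consistent (fun i => y (i + c)) r s ↔ Consistent y (r + c) (s + c) := by
  constructor
  · intro h l n h1 h2 hm
    have := h (l - c) (n - c) (by omega) (by omega) (by
      change IsMatch (fun i => shape y (i + c)) _ _
      rw [isMatch_shift, sub_add_cancel, sub_add_cancel]; exact hm)
    simpa only [sub_add_cancel] using this
  · intro h l n h1 h2 hm
    exact h (l + c) (n + c) (by omega) (by omega) (isMatch_shift.1 hm)

theorem dyckLaw_cyl_shift [NeZero m] (y : ℤ → DyckLetter m) (c r s : ℤ) :
    dyckLaw m (cyl (fun i => y (i + c)) r s) = dyckLaw m (cyl y (r + c) (s + c)) := by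
  by_cases h : Consistent y (r + c) (s + c)
  · rw [dyckLaw_cyl h, dyckLaw_cyl (consistent_shift.2 h), add_sub_add_right_eq_sub,
      ← card_freshSet_shift]
    rfl
  · rw [dyckLaw_cyl_of_not_consistent h,
      dyckLaw_cyl_of_not_consistent (mt consistent_shift.1 h)]

theorem measurable_shift {A : Type*} [MeasurableSpace A] (c : ℤ) :
    Measurable fun (x : ℤ → A) n => x (n + c) :=
  measurable_pi_lambda _ fun _ => measurable_pi_apply _

theorem map_shift_dyckLaw [NeZero m] (c : ℤ) :
    (dyckLaw m).map (fun x n => x (n + c)) = dyckLaw m := by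
  have := Measure.isProbabilityMeasure_map (μ := dyckLaw m)
    (measurable_shift (A := DyckLetter m) c).aemeasurable
  ext B hB
  refine measure_eq_of_eventually_cyl_eq hB fun x _ => Eventually.of_forall fun k => ?_
  rw [Measure.map_apply (measurable_shift c) (measurableSet_cyl _ _ _)]
  have h1 : (fun (y : ℤ → DyckLetter m) n => y (n + c)) ⁻¹' cyl x (-k) (k + 1) =
      cyl (fun n => x (n - c)) (-k + c) (k + 1 + c) := by
    ext y
    constructor
    · intro hy n h1 h2
      have := hy (n - c) (by omega) (by omega)
      dsimp only at this
      rwa [sub_add_cancel] at this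
    · intro hy n h1 h2
      have := hy (n + c) (by omega) (by omega)
      dsimp only at this
      rwa [add_sub_cancel_right] at this
  rw [h1, ← dyckLaw_cyl_shift]
  simp only [add_sub_cancel_right]

theorem measurable_dyckShift_shift : Measurable (DyckShift.shift (m := m)) :=
  ((measurable_shift 1).comp measurable_subtype_coe).subtype_mk

theorem measurePreserving_shift [NeZero m] :
    MeasurePreserving (DyckShift.shift (m := m)) (thirdMeasure m) (thirdMeasure m) := by
  refine ⟨measurable_dyckShift_shift, ?_⟩
  ext B hB
  obtain ⟨B', hB', rfl⟩ := hB
  rw [Measure.map_apply measurable_dyckShift_shift (measurable_subtype_coe hB'),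
    thirdMeasure_preimage_val hB', ← map_shift_dyckLaw 1, Measure.map_apply (measurable_shift 1) hB',
    ← thirdMeasure_preimage_val (measurable_shift 1 hB')]
  rfl

/-! ### Open brackets at time zero -/

theorem isGreatest_openAt {z : ℤ → Bool} (hz : z ∈ unboundedBelow) (n : ℤ) (j : ℕ) :
    IsGreatest {l : ℤ | l < n ∧ height z l < height z n - j} (openAt z n j) := by
  obtain ⟨l, h1, h2⟩ := exists_left_le hz n (height z n - j - 1)
  exact isGreatest_sSup_int ⟨l, h1, by omega⟩ ⟨n, fun _ hl => hl.1.le⟩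

/-- After its last visit below the level the walk must be at or above it one step later, so this
step goes up and starts exactly one below the level. -/
theorem openAt_spec {z : ℤ → Bool} (hz : z ∈ unboundedBelow) (n : ℤ) (j : ℕ) :
    z (openAt z n j) = true ∧ height z (openAt z n j) = height z n - j - 1 := by
  obtain ⟨⟨h1, h2⟩, h3⟩ := isGreatest_openAt hz n j
  have h4 : height z n - j ≤ height z (openAt z n j + 1) := by
    rcases (show openAt z n j + 1 < n ∨ openAt z n j + 1 = n by omega) with h | h
    · by_contra hc
      have := h3 (show openAt z n j + 1 ∈ _ from ⟨h, by omega⟩)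
      omega
    · rw [h]; omega
  rcases height_succ_cases z (openAt z n j) with ⟨h5, h6⟩ | ⟨h5, h6⟩
  · exact ⟨h5, by omega⟩
  · omega

theorem openAt_injective {z : ℤ → Bool} (hz : z ∈ unboundedBelow) (n : ℤ) :
    Function.Injective (openAt z n) := fun i j h => by
  have h1 := (openAt_spec hz n i).2
  have h2 := (openAt_spec hz n j).2
  rw [h] at h1
  omega

/-- The colours of the brackets that are open at time zero are eventually periodic. -/
def StackPeriodic (x : ℤ → DyckLetter m) : Prop :=
  ∃ e : ℕ, 0 < e ∧ ∃ h₀ : ℕ, ∀ h : ℕ, (x (openAt (shape x) 0 (h₀ + h + e))).colour =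
    (x (openAt (shape x) 0 (h₀ + h))).colour

theorem measurable_shape : Measurable (shape (m := m)) :=
  measurable_pi_lambda _ fun n => (measurable_of_countable _).comp (measurable_pi_apply n)

theorem measurableSet_stackPeriodic : MeasurableSet {x : ℤ → DyckLetter m | StackPeriodic x} := by
  have h1 : Measurable fun q : ℤ × (ℤ → DyckLetter m) => (q.2 q.1).colour :=
    measurable_from_prod_countable_right fun i =>
      (measurable_of_countable DyckLetter.colour).comp (measurable_pi_apply i)
  have h2 : ∀ j, Measurable fun x : ℤ → DyckLetter m => (x (openAt (shape x) 0 j)).colour :=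
    fun j => h1.comp (((measurable_openAt 0 j).comp measurable_shape).prodMk measurable_id)
  exact measurableSet_setOfPred.2 (.exists fun e => measurable_const.and (.exists fun h₀ =>
    .forall fun h => measurableSet_setOfPred.1 (measurableSet_eq_fun (h2 _) (h2 _))))

/-- For a fixed walk, the brackets open at time zero have distinct colour indices, so their colours
are independent and uniform; the possible periods and starting depths are countable. -/
theorem dyckLaw_stackPeriodic [NeZero m] (hm : 2 ≤ m) :
    dyckLaw m {x | StackPeriodic x} = 0 := by
  rw [dyckLaw_eq_map, Measure.map_apply (measurable_colourMap m) measurableSet_stackPeriodic,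
    Measure.measure_prod_null (measurable_colourMap m measurableSet_stackPeriodic)]
  filter_upwards [ae_mem_unboundedBelow] with z hz
  set t : ℕ → ℤ := fun j => colourIndex z (openAt z 0 j) with ht
  have hinj : Function.Injective t := by
    intro i j h
    have hi := (openAt_spec hz 0 i).1
    have hj := (openAt_spec hz 0 j).1
    simp only [ht, colourIndex, opening_of_true hi, opening_of_true hj] at h
    exact openAt_injective hz 0 (onesIndex_injOn z hi hj h)
  have hsub : Prod.mk z ⁻¹' (colourMap m ⁻¹' {x | StackPeriodic x}) ⊆
      ⋃ (e : ℕ) (_ : 0 < e) (h₀ : ℕ), {a | ∀ h, a (t (h₀ + (h + e))) = a (t (h₀ + h))} := by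
    rintro a ⟨e, he, h₀, h⟩
    simp only [Set.mem_iUnion]
    refine ⟨e, he, h₀, fun i => ?_⟩
    have := h i
    rw [shape_colourMap, colour_colourMap, colour_colourMap, add_assoc] at this
    exact this
  refine measure_mono_null hsub (measure_iUnion_null fun e => measure_iUnion_null fun he =>
    measure_iUnion_null fun h₀ => ?_)
  exact symmetricProduct_periodic_eq_zero (by simpa using hm) (fun h => t (h₀ + h))
    (hinj.comp (add_right_injective h₀)) e he

/-! ### Changing finitely many coordinates -/

/-- The increment of the walk over `[r, s)`. -/
def rise (z : ℤ → Bool) (r s : ℤ) : ℤ := height z s - height z r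

theorem height_left {z z' : ℤ → Bool} {r l : ℤ} (h : ∀ n, n < r → z n = z' n) (hl : l ≤ r) :
    height z' l = height z l + (height z' r - height z r) := by
  have := height_sub_congr hl fun i _ h2 => h i h2
  omega

theorem height_right {z z' : ℤ → Bool} {s l : ℤ} (h : ∀ n, s ≤ n → z n = z' n) (hl : s ≤ l) :
    height z' l = height z l + (height z' s - height z s) := by
  have := height_sub_congr hl fun i h1 _ => h i h1
  omega

theorem mem_unboundedBelow_of_tail {z z' : ℤ → Bool} {r s : ℤ} (h1 : ∀ n, n < r → z n = z' n)
    (h2 : ∀ n, s ≤ n → z n = z' n) (hz : z ∈ unboundedBelow) : z' ∈ unboundedBelow := by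
  constructor <;> intro c
  · obtain ⟨l, h3, h4⟩ := exists_right_le hz (max s 0) (c - 1 - (height z' s - height z s))
    refine ⟨l, by omega, ?_⟩
    rw [height_right h2 (by omega)]
    omega
  · obtain ⟨l, h3, h4⟩ := exists_left_le hz (min r 0) (c - 1 - (height z' r - height z r))
    refine ⟨l, by omega, ?_⟩
    rw [height_left h1 (by omega)]
    omega

theorem exists_window_bound (z z' : ℤ → Bool) (r s : ℤ) :
    ∃ b, ∀ i, r ≤ i → i ≤ s → b < height z i ∧ b < height z' i := by
  obtain ⟨b, hb⟩ := ((Set.finite_Icc r s).image (height z)).bddBelow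
  obtain ⟨b', hb'⟩ := ((Set.finite_Icc r s).image (height z')).bddBelow
  refine ⟨min b b' - 1, fun i h1 h2 => ?_⟩
  have := hb ⟨i, ⟨h1, h2⟩, rfl⟩
  have := hb' ⟨i, ⟨h1, h2⟩, rfl⟩
  omega

/-- A closing bracket `n` far to the right is matched in `x` with the opening `l` at depth `h` and
in `x'` with the opening `l'` at depth `h'`, the depths differing by the change of rise. Since `x`
and `x'` agree at `n` and at `l'`, the colours of `x` at `l` and `l'` coincide. -/
theorem eventually_colour_eq {x x' : ℤ → DyckLetter m} (hx : x ∈ dyckShift m)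
    (hx' : x' ∈ dyckShift m) (hz : shape x ∈ unboundedBelow) {r s : ℤ} (hr : r ≤ 0) (hs : 0 ≤ s)
    (h1 : ∀ n, n < r → x n = x' n) (h2 : ∀ n, s ≤ n → x n = x' n) :
    ∃ h₀ : ℕ, ∀ h h' : ℕ, h₀ ≤ h → h₀ ≤ h' →
      (h : ℤ) - h' = rise (shape x') r s - rise (shape x) r s →
        (x (openAt (shape x) 0 h)).colour = (x (openAt (shape x) 0 h')).colour := by
  set z := shape x
  set z' := shape x'
  have hl : ∀ n, n < r → z n = z' n := fun n hn => congrArg DyckLetter.isAlpha (h1 n hn)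
  have hr' : ∀ n, s ≤ n → z n = z' n := fun n hn => congrArg DyckLetter.isAlpha (h2 n hn)
  obtain ⟨b, hb⟩ := exists_window_bound z z' r s
  set c₁ := height z' r - height z r with hc₁
  set c₂ := height z' s - height z s with hc₂
  -- At these depths the relevant levels of both walks lie below everything over `[r, s]`, so the
  -- modified part cannot interrupt either match.
  refine ⟨b.natAbs + c₁.natAbs + c₂.natAbs, fun h h' hh hh' hd => ?_⟩
  unfold rise at hd
  have hzero := height_zero z
  obtain ⟨⟨p1, -⟩, p3⟩ := isGreatest_openAt hz 0 h
  have p4 := (openAt_spec hz 0 h).2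
  obtain ⟨⟨q1, -⟩, q3⟩ := isGreatest_openAt hz 0 h'
  have q4 := (openAt_spec hz 0 h').2
  set l := openAt z 0 h
  set l' := openAt z 0 h'
  -- the first passage to the height of `l` on the right closes both brackets
  have hbs := hb s (by omega) le_rfl
  obtain ⟨i, hi1, hi2, hi3⟩ := exists_first_passage (z := z) (r := s) (c := -h - 1) (by omega)
    (exists_right_le hz s _)
  have his : i ≠ s := by rintro rfl; omega
  obtain ⟨n, rfl⟩ : ∃ n, i = n + 1 := ⟨i - 1, by ring⟩
  have hn : z n = false := by
    have := hi3 n (by omega) (by omega)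
    rcases height_succ_cases z n with ⟨_, h6⟩ | ⟨h5, _⟩
    · omega
    · exact h5
  have hlow : ∀ j : ℕ, ∀ i, openAt z 0 j < i → i < 0 → -(j : ℤ) - 1 < height z i := by
    intro j i h3 h4
    by_contra hc
    have := (isGreatest_openAt hz 0 j).2 (show i ∈ _ from ⟨h4, by omega⟩)
    omega
  have hrl' : l' < r := by
    by_contra hc
    have := (hb l' (by omega) (by omega)).1
    omega
  have m1 : IsMatch z l n := by
    refine ⟨by omega, hn, by omega, fun i h3 h4 => ?_⟩
    rcases lt_or_ge i 0 with h5 | h5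
    · have := hlow h i h3 h5
      omega
    · rcases lt_or_ge i s with h6 | h6
      · have := (hb i (by omega) h6.le).1
        omega
      · have := hi3 i h6 (by omega)
        omega
  have m2 : IsMatch z' l' n := by
    have e1 := height_right hr' (l := n + 1) (by omega)
    refine ⟨by omega, (hr' n (by omega)).symm.trans hn, ?_, fun i h3 h4 => ?_⟩
    · have := height_left hl hrl'.le
      omega
    · rcases lt_or_ge i r with h5 | h5
      · have := hlow h' i h3 (by omega)
        have := height_left hl h5.le
        omega
      · rcases lt_or_ge i s with h6 | h6
        · have := (hb i h5 h6.le).2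
          omega
        · have := hi3 i h6 (by omega)
          have := height_right hr' h6
          omega
  have t1 := consistent_of_mem hx l (n + 1) l n le_rfl (by omega) m1
  have t2 := consistent_of_mem hx' l' (n + 1) l' n le_rfl (by omega) m2
  rw [t1, h2 n (by omega), ← t2, h1 l' hrl']

theorem stackPeriodic_of_rise_ne {x x' : ℤ → DyckLetter m} (hx : x ∈ dyckShift m)
    (hx' : x' ∈ dyckShift m) (hz : shape x ∈ unboundedBelow) {r s : ℤ} (hr : r ≤ 0) (hs : 0 ≤ s)
    (h1 : ∀ n, n < r → x n = x' n) (h2 : ∀ n, s ≤ n → x n = x' n)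
    (hne : rise (shape x') r s ≠ rise (shape x) r s) : StackPeriodic x := by
  obtain ⟨h₀, h⟩ := eventually_colour_eq hx hx' hz hr hs h1 h2
  refine ⟨(rise (shape x') r s - rise (shape x) r s).natAbs, by omega, h₀, fun i => ?_⟩
  rcases lt_or_gt_of_ne hne with h3 | h3
  · exact (h _ _ (by omega) (by omega) (by omega)).symm
  · exact h _ _ (by omega) (by omega) (by omega)

/-- With equal rises the walks differ by the same constant `c` on both tails. Over a large window
both minima can be compared outside the modified part, so they also differ by `c`, and `c` cancels
in `H(s) + H(r) - 2 min H`. -/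
theorem eventually_card_freshSet_eq {z z' : ℤ → Bool} (hz : z ∈ unboundedBelow) {r s : ℤ}
    (hrs : r ≤ s) (h1 : ∀ n, n < r → z n = z' n) (h2 : ∀ n, s ≤ n → z n = z' n)
    (he : rise z' r s = rise z r s) :
    ∀ᶠ k : ℕ in atTop, (freshSet z (-k) (k + 1)).card = (freshSet z' (-k) (k + 1)).card := by
  obtain ⟨b, hb⟩ := exists_window_bound z z' r s
  unfold rise at he
  set c := height z' r - height z r with hc
  have hl : ∀ l ≤ r, height z' l = height z l + c := fun l hl => height_left h1 hl
  have hr : ∀ l, s ≤ l → height z' l = height z l + c := fun l hl => by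
    have := height_right h2 hl
    omega
  -- The margin `|c|` puts `i` at or below `b` in both walks, hence below everything over `[r, s]`.
  obtain ⟨i, hi1, hi2⟩ := exists_right_le hz s (b - |c|)
  have hc1 := le_abs_self c
  have hc2 := neg_abs_le c
  filter_upwards [eventually_ge_atTop (i.natAbs + r.natAbs + s.natAbs)] with k hk
  obtain ⟨l, l1, l2, l3, l4⟩ := exists_min_card_freshSet z (r := -k) (s := k + 1) (by omega)
  obtain ⟨l', l1', l2', l3', l4'⟩ := exists_min_card_freshSet z' (r := -k) (s := k + 1) (by omega)
  have hi := l3 i (by omega) (by omega)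
  have hi' := l3' i (by omega) (by omega)
  have e1 := hr i hi1
  have e2 := hr (k + 1) (by omega)
  have e3 := hl (-k) (by omega)
  have key : height z' l = height z l + c := by
    rcases le_total l r with h | h
    · exact hl l h
    · rcases le_total s l with h' | h'
      · exact hr l h'
      · have := (hb l h h').1; omega
  have key' : height z' l' = height z l' + c := by
    rcases le_total l' r with h | h
    · exact hl l' h
    · rcases le_total s l' with h' | h'
      · exact hr l' h'
      · have := (hb l' h h').2; omega
  have f1 := l3 l' l1' l2'
  have f2 := l3' l l1 l2
  have : (2 : ℤ) * (freshSet z (-k) (k + 1)).card = 2 * (freshSet z' (-k) (k + 1)).card := by omega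
  omega

/-- The sequence `x` with the word `v` written over `[-k, k]`. -/
def splice {A : Type*} (k : ℕ) (v : Set.Ico (-(k : ℤ)) (k + 1) → A) (x : ℤ → A) : ℤ → A :=
  fun n => if h : n ∈ Set.Ico (-(k : ℤ)) (k + 1) then v ⟨n, h⟩ else x n

section Splice

variable {A : Type*} {k : ℕ} {u v : Set.Ico (-(k : ℤ)) (k + 1) → A} {x y : ℤ → A}

theorem splice_of_mem {n : ℤ} (h : n ∈ Set.Ico (-(k : ℤ)) (k + 1)) : splice k v x n = v ⟨n, h⟩ :=
  dif_pos h

theorem splice_of_notMem {n : ℤ} (h : n ∉ Set.Ico (-(k : ℤ)) (k + 1)) : splice k v x n = x n :=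
  dif_neg h

theorem splice_of_lt {n : ℤ} (h : n < -k) : splice k v x n = x n :=
  splice_of_notMem fun hn => by have := hn.1; omega

theorem splice_of_ge {n : ℤ} (h : (k : ℤ) + 1 ≤ n) : splice k v x n = x n :=
  splice_of_notMem fun hn => by have := hn.2; omega

theorem window_splice : window k (splice k v x) = v :=
  funext fun n => splice_of_mem n.2

theorem splice_splice : splice k u (splice k v x) = splice k u x := by
  funext n
  by_cases h : n ∈ Set.Ico (-(k : ℤ)) (k + 1)
  · rw [splice_of_mem h, splice_of_mem h]
  · rw [splice_of_notMem h, splice_of_notMem h, splice_of_notMem h]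

theorem splice_window : splice k (window k x) x = x := by
  funext n
  by_cases h : n ∈ Set.Ico (-(k : ℤ)) (k + 1)
  · rw [splice_of_mem h]; rfl
  · rw [splice_of_notMem h]

theorem splice_eq_self (h : window k x = u) : splice k u x = x := by
  rw [← h, splice_window]

theorem measurable_splice [MeasurableSpace A] : Measurable (splice k v) := by
  refine measurable_pi_lambda _ fun n => ?_
  by_cases h : n ∈ Set.Ico (-(k : ℤ)) (k + 1)
  · simp only [splice_of_mem h]; exact measurable_const
  · simp only [splice_of_notMem h]; exact measurable_pi_apply n

/-- On sequences with word `u` over the window, writing `v` is undone by writing `u` again, so the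
image is a preimage. -/
theorem image_splice {B : Set (ℤ → A)} (hB : ∀ x ∈ B, window k x = u) :
    splice k v '' B = window k ⁻¹' {v} ∩ splice k u ⁻¹' B := by
  ext y
  constructor
  · rintro ⟨x, hx, rfl⟩
    refine ⟨window_splice, ?_⟩
    rw [Set.mem_preimage, splice_splice, splice_eq_self (hB x hx)]
    exact hx
  · rintro ⟨h1, h2⟩
    exact ⟨_, h2, by rw [splice_splice, splice_eq_self h1]⟩

theorem cyl_splice {l : ℕ} (hkl : k ≤ l) (hx : window k x = u) :
    window k ⁻¹' {v} ∩ splice k u ⁻¹' cyl x (-l) (l + 1) = cyl (splice k v x) (-l) (l + 1) := by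
  ext y
  constructor
  · rintro ⟨h1, h2⟩ n h3 h4
    have := h2 n h3 h4
    by_cases h : n ∈ Set.Ico (-(k : ℤ)) (k + 1)
    · rw [splice_of_mem h]; exact congrFun h1 ⟨n, h⟩
    · rwa [splice_of_notMem h] at this ⊢
  · intro hy
    refine ⟨funext fun n => ?_, fun n h3 h4 => ?_⟩
    · have := hy n (by have := n.2.1; omega) (by have := n.2.2; omega)
      rwa [splice_of_mem n.2] at this
    · by_cases h : n ∈ Set.Ico (-(k : ℤ)) (k + 1)
      · rw [splice_of_mem h]; exact (congrFun hx ⟨n, h⟩).symm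
      · have := hy n h3 h4
        rwa [splice_of_notMem h] at this ⊢

end Splice

theorem dyckLaw_ae_shape_mem [NeZero m] : ∀ᵐ x ∂dyckLaw m, shape x ∈ unboundedBelow := by
  rw [dyckLaw_eq_map]
  refine (ae_map_iff (p := fun x => shape x ∈ unboundedBelow) (measurable_colourMap m).aemeasurable
    (measurable_shape measurableSet_unboundedBelow)).2 ?_
  filter_upwards [(Measure.quasiMeasurePreserving_fst (μ := symmetricProduct Bool)
    (ν := symmetricProduct (Fin m))).ae ae_mem_unboundedBelow] with p hp
  rwa [shape_colourMap]

/-- The measure of the image is `ν B` for an auxiliary finite measure `ν`. On the part of `B` where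
the rise is preserved, `ν` and `dyckLaw m` agree on all large cylinders; the rest is null for both
because of periodic stacks. -/
theorem dyckLaw_image_splice [NeZero m] {k : ℕ} {u v : Set.Ico (-(k : ℤ)) (k + 1) → DyckLetter m}
    {B : Set (ℤ → DyckLetter m)} (hB : MeasurableSet B) (hu : ∀ x ∈ B, window k x = u)
    (hX : B ⊆ dyckShift m) (hX' : splice k v '' B ⊆ dyckShift m) :
    dyckLaw m (splice k v '' B) = dyckLaw m B := by
  have hv : MeasurableSet (window k ⁻¹' {v} : Set (ℤ → DyckLetter m)) :=
    measurable_window k (measurableSet_singleton v)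
  set ν := ((dyckLaw m).restrict (window k ⁻¹' {v})).map (splice k u) with hν
  have hνa : ∀ C, MeasurableSet C → ν C = dyckLaw m (window k ⁻¹' {v} ∩ splice k u ⁻¹' C) := by
    intro C hC
    rw [hν, Measure.map_apply measurable_splice hC,
      Measure.restrict_apply (measurable_splice hC), Set.inter_comm]
  have : IsFiniteMeasure ν := by rw [hν]; infer_instance
  rw [image_splice hu, ← hνa B hB]
  have hl : ∀ (x : ℤ → DyckLetter m) n, n < -(k : ℤ) → x n = splice k v x n := fun x n hn =>
    (splice_of_lt hn).symm
  have hr : ∀ (x : ℤ → DyckLetter m) n, (k : ℤ) + 1 ≤ n → x n = splice k v x n := fun x n hn =>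
    (splice_of_ge hn).symm
  have hls : ∀ (x : ℤ → DyckLetter m) n, n < -(k : ℤ) → shape x n = shape (splice k v x) n :=
    fun x n hn => congrArg DyckLetter.isAlpha (hl x n hn)
  have hrs : ∀ (x : ℤ → DyckLetter m) n, (k : ℤ) + 1 ≤ n → shape x n = shape (splice k v x) n :=
    fun x n hn => congrArg DyckLetter.isAlpha (hr x n hn)
  -- With a single colour every stack is periodic and the null-set argument fails, but then `m^(-D)
  -- = 1` and any change of `D` is harmless.
  set G : Set (ℤ → DyckLetter m) := {x | shape x ∈ unboundedBelow ∧
    (m = 1 ∨ rise (shape (splice k v x)) (-k) (k + 1) = rise (shape x) (-k) (k + 1))} with hG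
  have hGm : MeasurableSet G := by
    have h1 : ∀ i, Measurable fun x : ℤ → DyckLetter m => height (shape x) i := fun i =>
      (measurable_height i).comp measurable_shape
    have h2 : ∀ i, Measurable fun x : ℤ → DyckLetter m => height (shape (splice k v x)) i :=
      fun i => (h1 i).comp measurable_splice
    exact measurableSet_setOfPred.2 ((measurableSet_setOfPred.1
      (measurable_shape measurableSet_unboundedBelow)).and (measurable_const.or
        (measurableSet_setOfPred.1 (measurableSet_eq_fun ((h2 _).sub (h2 _))
          ((h1 _).sub (h1 _))))))
  have hbad : dyckLaw m ({x | shape x ∉ unboundedBelow} ∪ {x | 2 ≤ m ∧ StackPeriodic x}) = 0 := by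
    refine measure_union_null dyckLaw_ae_shape_mem ?_
    by_cases hm : 2 ≤ m
    · simpa [hm] using dyckLaw_stackPeriodic hm
    · simp [hm]
  have hm0 : m ≠ 0 := NeZero.ne m
  have n1 : dyckLaw m (B \ G) = 0 := by
    refine measure_mono_null (fun x hx => ?_) hbad
    by_cases hz : shape x ∈ unboundedBelow
    · have hx2 := hx.2
      simp only [hG, Set.mem_ofPred_eq, not_and, not_or] at hx2
      obtain ⟨h1, h2⟩ := hx2 hz
      exact Or.inr ⟨by omega, stackPeriodic_of_rise_ne (hX hx.1) (hX' ⟨x, hx.1, rfl⟩) hz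
        (by omega) (by omega) (hl x) (hr x) h2⟩
    · exact Or.inl hz
  -- The same argument with the original and the spliced sequence exchanged.
  have n2 : ν (B \ G) = 0 := by
    rw [hνa _ (hB.diff hGm), ← image_splice fun x hx => hu x hx.1]
    refine measure_mono_null ?_ hbad
    rintro _ ⟨x, hx, rfl⟩
    by_cases hz : shape (splice k v x) ∈ unboundedBelow
    · have hx2 := hx.2
      simp only [hG, Set.mem_ofPred_eq, not_and, not_or] at hx2
      obtain ⟨h1, h2⟩ := hx2 (mem_unboundedBelow_of_tail (fun n hn => (hls x n hn).symm)
        (fun n hn => (hrs x n hn).symm) hz)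
      exact Or.inr ⟨by omega, stackPeriodic_of_rise_ne (hX' ⟨x, hx.1, rfl⟩) (hX hx.1) hz
        (by omega) (by omega) (fun n hn => (hl x n hn).symm) (fun n hn => (hr x n hn).symm)
        (Ne.symm h2)⟩
    · exact Or.inl hz
  rw [← measure_inter_add_sdiff (μ := ν) B hGm, ← measure_inter_add_sdiff (μ := dyckLaw m) B hGm, n1, n2,
    add_zero, add_zero]
  refine (measure_eq_of_eventually_cyl_eq (hB.inter hGm) fun x hx => ?_).symm
  have hcard : ∀ᶠ l : ℕ in atTop, (m : ENNReal)⁻¹ ^ (freshSet (shape x) (-l) (l + 1)).card =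
      (m : ENNReal)⁻¹ ^ (freshSet (shape (splice k v x)) (-l) (l + 1)).card := by
    rcases hx.2.2 with h | h
    · exact Eventually.of_forall fun l => by simp [h]
    · filter_upwards [eventually_card_freshSet_eq hx.2.1 (by omega) (hls x) (hrs x) h] with l hl
      rw [hl]
  filter_upwards [hcard, eventually_ge_atTop k] with l h1 h2
  rw [hνa _ (measurableSet_cyl _ _ _), cyl_splice h2 (hu x hx.1),
    dyckLaw_cyl (consistent_of_mem (hX hx.1) _ _),
    dyckLaw_cyl (consistent_of_mem (hX' ⟨x, hx.1, rfl⟩) _ _), h1]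

/-! ### Double-tail invariance -/

/-- By Lusin–Souslin an injective Borel map between standard Borel spaces is a measurable embedding,
so pulling back along `g` gives a measure on `A`, to be compared with the restriction of the given
one. -/
theorem doubleTailInvariant_thirdMeasure [NeZero m] : DoubleTailInvariant (thirdMeasure m) := by
  intro A hA g hg hinj htail
  have hX := measurableSet_dyckShift (m := m)
  have : StandardBorelSpace (DyckShift m) := hX.standardBorel
  have : StandardBorelSpace A := hA.standardBorel
  have eX : MeasurableEmbedding (Subtype.val : DyckShift m → ℤ → DyckLetter m) :=
    .subtype_coe hX
  have eA : MeasurableEmbedding (Subtype.val : A → DyckShift m) := .subtype_coe hA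
  have eg : MeasurableEmbedding g := hg.measurableEmbedding hinj
  have law : ∀ C : Set (DyckShift m), thirdMeasure m C = dyckLaw m (Subtype.val '' C) := fun C =>
    eX.comap_apply _ _
  suffices h : (thirdMeasure m).comap (Subtype.val : A → DyckShift m) = (thirdMeasure m).comap g by
    have := congrArg (fun ρ => ρ Set.univ) h
    simpa only [eA.comap_apply, eg.comap_apply, Set.image_univ, Subtype.range_coe] using this
  -- Pieces on which `g` replaces the word `u` over `[-k, k]` by `v`. There are countably many, and
  -- they may overlap: equality of the restrictions to each piece suffices.
  let P : (Σ k : ℕ, (Set.Ico (-(k : ℤ)) (k + 1) → DyckLetter m) ×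
      (Set.Ico (-(k : ℤ)) (k + 1) → DyckLetter m)) → Set A := fun i =>
    {a | window i.1 a.1.1 = i.2.1 ∧ splice i.1 i.2.2 a.1.1 = (g a).1}
  have hcover : ⋃ i, P i = Set.univ := by
    refine Set.eq_univ_of_forall fun a => ?_
    obtain ⟨k, hk⟩ := htail a
    refine Set.mem_iUnion.2 ⟨⟨k, window k a.1.1, window k (g a).1⟩, rfl, funext fun n => ?_⟩
    dsimp only
    by_cases h : n ∈ Set.Ico (-(k : ℤ)) (k + 1)
    · rw [splice_of_mem h]; rfl
    · rw [splice_of_notMem h]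
      refine hk n ?_
      by_contra hc
      rw [not_lt, abs_le] at hc
      exact h ⟨hc.1, by omega⟩
  rw [← Measure.restrict_univ (μ := (thirdMeasure m).comap (Subtype.val : A → DyckShift m)),
    ← Measure.restrict_univ (μ := (thirdMeasure m).comap g), ← hcover, Measure.restrict_iUnion_congr]
  rintro ⟨k, u, v⟩
  ext t ht
  have hPm : MeasurableSet (P ⟨k, u, v⟩) := by
    have h1 : Measurable fun a : A => a.1.1 := measurable_subtype_coe.comp measurable_subtype_coe
    exact ((measurable_window k).comp h1 (measurableSet_singleton u)).inter
      (measurableSet_eq_fun (measurable_splice.comp h1) (measurable_subtype_coe.comp hg))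
  rw [Measure.restrict_apply ht, Measure.restrict_apply ht, eA.comap_apply, eg.comap_apply,
    law, law]
  have himg : Subtype.val '' (g '' (t ∩ P ⟨k, u, v⟩)) =
      splice k v '' (Subtype.val '' (Subtype.val '' (t ∩ P ⟨k, u, v⟩))) := by
    simp only [Set.image_image]
    exact Set.image_congr fun a ha => ha.2.2.symm
  rw [himg]
  refine (dyckLaw_image_splice (u := u) (eX.measurableSet_image.2 (eA.measurableSet_image.2
    (ht.inter hPm))) ?_ ?_ ?_).symm
  · rintro _ ⟨_, ⟨a, ha, rfl⟩, rfl⟩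
    exact ha.2.1
  · rintro _ ⟨x, _, rfl⟩
    exact x.2
  · rw [← himg]
    rintro _ ⟨x, _, rfl⟩
    exact x.2

/-! ### Entropy of finite partitions -/

theorem shannonEntropy_comp_equiv {Ω ι κ : Type*} [MeasurableSpace Ω] [Fintype ι] [Fintype κ]
    {μ : Measure Ω} (f : Ω → ι) (e : ι ≃ κ) :
    shannonEntropy μ (fun x => e (f x)) = shannonEntropy μ f := by
  unfold shannonEntropy
  rw [← e.sum_comp]
  refine Finset.sum_congr rfl fun i _ => ?_
  congr 2
  ext x
  simp

section Entropy

variable {Ω ι κ : Type*} [MeasurableSpace Ω] [Fintype ι] [MeasurableSpace ι]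
  [MeasurableSingletonClass ι]
  {μ : Measure Ω}

theorem sum_measureReal_preimage_mul [IsFiniteMeasure μ] {f : Ω → ι} (hf : Measurable f)
    (φ : ι → ℝ) : ∑ i, μ.real (f ⁻¹' {i}) * φ i = ∫ x, φ (f x) ∂μ := by
  have hφ : Measurable φ := measurable_of_countable φ
  rw [← integral_map hf.aemeasurable hφ.aestronglyMeasurable, integral_fintype .of_finite]
  refine Finset.sum_congr rfl fun i _ => ?_
  rw [smul_eq_mul, map_measureReal_apply hf (measurableSet_singleton i)]

theorem sum_measureReal_preimage_inter [IsFiniteMeasure μ] {f : Ω → ι} (hf : Measurable f)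
    (s : Set Ω) : ∑ i, μ.real (s ∩ f ⁻¹' {i}) = μ.real s := by
  have := sum_measureReal_preimage_mul (μ := μ.restrict s) hf fun _ => 1
  simp only [mul_one, integral_const, smul_eq_mul] at this
  rw [measureReal_restrict_apply .univ, Set.univ_inter] at this
  rw [← this]
  refine Finset.sum_congr rfl fun i _ => ?_
  rw [measureReal_restrict_apply (hf (measurableSet_singleton i)), Set.inter_comm]

variable [Fintype κ] [MeasurableSpace κ] [MeasurableSingletonClass κ]

/-- Entropy is at most the entropy of another partition plus the cost of encoding the former by
means of the latter with a given family of subprobabilities. -/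
theorem shannonEntropy_le_add [IsProbabilityMeasure μ] {f : Ω → ι} {g : Ω → κ} (hf : Measurable f)
    (hg : Measurable g) {c : κ → ι → ℝ} (hc : ∀ k, ∑ i, Real.exp (-c k i) ≤ 1) :
    shannonEntropy μ f ≤ shannonEntropy μ g + ∫ x, c (g x) (f x) ∂μ := by
  set p : ι → κ → ℝ := fun i k => μ.real (f ⁻¹' {i} ∩ g ⁻¹' {k}) with hp
  set a : ι → ℝ := fun i => μ.real (f ⁻¹' {i})
  set b : κ → ℝ := fun k => μ.real (g ⁻¹' {k})
  have hp0 : ∀ i k, 0 ≤ p i k := fun _ _ => measureReal_nonneg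
  have hb0 : ∀ k, 0 ≤ b k := fun _ => measureReal_nonneg
  have ha : ∀ i, ∑ k, p i k = a i := fun i =>
    sum_measureReal_preimage_inter hg _
  have hb : ∀ k, ∑ i, p i k = b k := fun k => by
    rw [show b k = μ.real (g ⁻¹' {k}) from rfl, ← sum_measureReal_preimage_inter hf]
    exact Finset.sum_congr rfl fun i _ => by rw [hp, Set.inter_comm]
  have hb1 : ∑ k, b k = 1 := by
    have := sum_measureReal_preimage_mul (μ := μ) hg fun _ => 1
    simpa using this
  have hint : ∫ x, c (g x) (f x) ∂μ = ∑ i, ∑ k, p i k * c k i := by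
    have := sum_measureReal_preimage_mul (μ := μ) (hf.prodMk hg) fun q => c q.2 q.1
    rw [← this, Fintype.sum_prod_type]
    refine Finset.sum_congr rfl fun i _ => Finset.sum_congr rfl fun k _ => ?_
    congr 2
    ext x
    simp
  -- For `p i k > 0` this is `log t ≤ t - 1` at `t = b k * exp (-c k i) / p i k`, combined with `p i
  -- k ≤ a i`. The last bracket has nonpositive sum because the weights are subprobabilities.
  have term : ∀ i k, p i k * -Real.log (a i) ≤
      p i k * -Real.log (b k) + p i k * c k i + (b k * Real.exp (-c k i) - p i k) := by
    intro i k
    rcases (hp0 i k).eq_or_lt with h | h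
    · rw [← h]
      have := mul_nonneg (hb0 k) (Real.exp_pos (-c k i)).le
      linarith
    · have h1 : p i k ≤ a i := measureReal_mono Set.inter_subset_left
      have h2 : p i k ≤ b k := measureReal_mono Set.inter_subset_right
      have h3 := Real.log_le_log h h1
      have h4 := Real.log_le_sub_one_of_pos
        (div_pos (mul_pos (h.trans_le h2) (Real.exp_pos (-c k i))) h)
      rw [Real.log_div (mul_pos (h.trans_le h2) (Real.exp_pos _)).ne' h.ne',
        Real.log_mul (h.trans_le h2).ne' (Real.exp_pos _).ne', Real.log_exp] at h4
      have h5 := mul_le_mul_of_nonneg_left h4 h.le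
      rw [mul_sub (p i k) (_ / _), mul_div_cancel₀ _ h.ne'] at h5
      have h6 := mul_le_mul_of_nonneg_left h3 h.le
      linarith
  have e1 : shannonEntropy μ f = ∑ i, ∑ k, p i k * -Real.log (a i) := by
    refine Finset.sum_congr rfl fun i _ => ?_
    rw [← Finset.sum_mul, ha, Real.negMulLog]
    ring
  have e2 : shannonEntropy μ g = ∑ i, ∑ k, p i k * -Real.log (b k) := by
    rw [Finset.sum_comm]
    refine Finset.sum_congr rfl fun k _ => ?_
    rw [← Finset.sum_mul, hb, Real.negMulLog]
    ring
  have e3 : ∑ i, ∑ k, (b k * Real.exp (-c k i) - p i k) ≤ 0 := by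
    rw [Finset.sum_comm]
    refine Finset.sum_nonpos fun k _ => ?_
    rw [Finset.sum_sub_distrib, ← Finset.mul_sum, hb]
    nlinarith [hb0 k, hc k]
  rw [e1, e2, hint]
  calc ∑ i, ∑ k, p i k * -Real.log (a i)
      ≤ ∑ i, ∑ k, (p i k * -Real.log (b k) + p i k * c k i +
          (b k * Real.exp (-c k i) - p i k)) :=
        Finset.sum_le_sum fun i _ => Finset.sum_le_sum fun k _ => term i k
    _ ≤ _ := by
        simp only [Finset.sum_add_distrib] at e3 ⊢
        linarith

end Entropy

/-! ### Entropy of the windows -/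

instance : Fintype (DyckLetter m) := Fintype.ofFinite _

/-- The word of length `N` that starts at position `r`. -/
def block (r : ℤ) (N : ℕ) (x : DyckShift m) : Fin N → DyckLetter m := fun i => x.1 (r + (i : ℕ))

theorem measurable_block (r : ℤ) (N : ℕ) : Measurable (block (m := m) r N) :=
  measurable_pi_lambda _ fun _ => (measurable_pi_apply _).comp measurable_subtype_coe

theorem preimage_block_singleton (r : ℤ) (N : ℕ) (x : DyckShift m) :
    block r N ⁻¹' {block r N x} = Subtype.val ⁻¹' cyl x.1 r (r + N) := by
  ext y
  simp only [Set.mem_preimage, Set.mem_singleton_iff, funext_iff, block, cyl, Set.mem_ofPred_eq]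
  constructor
  · intro h n h1 h2
    have := h ⟨(n - r).toNat, by omega⟩
    change y.1 (r + ((n - r).toNat : ℤ)) = x.1 (r + ((n - r).toNat : ℤ)) at this
    rwa [show r + ((n - r).toNat : ℤ) = n by omega] at this
  · intro h i
    exact h _ (by omega) (by have := i.2; omega)

theorem measurable_fresh (r n : ℤ) : Measurable fun z : ℤ → Bool => Fresh z r n :=
  Measurable.or (measurableSet_setOfPred.1
    (measurableSet_eq_fun (measurable_pi_apply n) measurable_const))
    (.forall fun _ => measurable_const.imp (measurable_const.imp (measurableSet_setOfPred.1
      (measurableSet_lt (measurable_height _) (measurable_height _)))))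

theorem measurableSet_fresh (r n : ℤ) :
    MeasurableSet {x : ℤ → DyckLetter m | Fresh (shape x) r n} :=
  measurable_shape (measurableSet_setOfPred.2 (measurable_fresh r n))

/-- The probability that a bracket is not matched with one of the `i` brackets before it. -/
def freshProb (m i : ℕ) : ℝ := (dyckLaw m).real {x | Fresh (shape x) (-i) 0}

theorem measureReal_fresh [NeZero m] (r : ℤ) (i : ℕ) :
    (thirdMeasure m).real {x | Fresh (shape x.1) r (r + i)} = freshProb m i := by
  unfold freshProb
  have h := thirdMeasure_preimage_val (measurableSet_fresh (m := m) r (r + i))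
  rw [← map_shift_dyckLaw (r + i), map_measureReal_apply (measurable_shift _) (measurableSet_fresh _ _),
    measureReal_def, measureReal_def]
  rw [show {x : DyckShift m | Fresh (shape x.1) r (r + i)} =
    Subtype.val ⁻¹' {x | Fresh (shape x) r (r + i)} from rfl, h]
  congr 2
  ext x
  change Fresh (shape x) _ _ ↔ Fresh (fun n => shape x (n + (r + i))) _ _
  rw [fresh_shift]
  congr! 1 <;> ring

/-- The entropy of a window of `N` letters. -/
def windowEntropy (m N : ℕ) : ℝ :=
  N * Real.log 2 + Real.log m * ∑ i ∈ Finset.range N, freshProb m i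

/-- Minus the logarithm of the measure of a word is `N log 2 + D log m`, so the entropy is its mean;
`D` is a sum of indicators of freshness. -/
theorem shannonEntropy_block [NeZero m] (r : ℤ) (N : ℕ) :
    shannonEntropy (thirdMeasure m) (block r N) = windowEntropy m N := by
  classical
  -- an extension of each word to a point
  obtain ⟨x₀⟩ : Nonempty (DyckShift m) := (thirdMeasure m).nonempty_of_neZero
  set y : (Fin N → DyckLetter m) → DyckShift m := fun w => Function.extend (block r N) id
    (fun _ => x₀) w with hy
  set D : DyckShift m → ℕ := fun x => (freshSet (shape x.1) r (r + N)).card with hD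
  have hDy : ∀ x, D (y (block r N x)) = D x := by
    intro x
    have h : block r N (y (block r N x)) = block r N x := by
      by_cases hex : ∃ a, block r N a = block r N x
      · simp only [hy, Function.extend_def, dif_pos hex, id]
        exact hex.choose_spec
      · exact absurd ⟨x, rfl⟩ hex
    have h2 : y (block r N x) ∈ Subtype.val ⁻¹' cyl x.1 r (r + N) := by
      rw [← preimage_block_singleton]; exact h
    simp only [hD]
    rw [freshSet_congr (z := shape (y (block r N x)).1) (z' := shape x.1) fun i h3 h4 => congrArg DyckLetter.isAlpha (h2 i h3 h4)]
  have hm0 : (0 : ℝ) < m := by exact_mod_cast Nat.pos_of_ne_zero (NeZero.ne m)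
  have term : ∀ w, Real.negMulLog ((thirdMeasure m).real (block r N ⁻¹' {w})) =
      (thirdMeasure m).real (block r N ⁻¹' {w}) * (N * Real.log 2 + D (y w) * Real.log m) := by
    intro w
    by_cases hw : ∃ x, block r N x = w
    · obtain ⟨x, rfl⟩ := hw
      rw [hDy]
      have hv : (thirdMeasure m).real (block r N ⁻¹' {block r N x}) =
          (2⁻¹ : ℝ) ^ N * (m : ℝ)⁻¹ ^ D x := by
        rw [preimage_block_singleton, measureReal_def,
          thirdMeasure_preimage_val (measurableSet_cyl _ _ _),
          dyckLaw_cyl (consistent_of_mem x.2 _ _)]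
        simp [hD]
      rw [Real.negMulLog, hv, Real.log_mul (by positivity) (by positivity), Real.log_pow,
        Real.log_pow, Real.log_inv, Real.log_inv]
      ring
    · have : block r N ⁻¹' {w} = ∅ := Set.eq_empty_of_forall_notMem fun x hx => hw ⟨x, hx⟩
      rw [this]
      simp
  unfold shannonEntropy
  rw [Finset.sum_congr rfl fun w _ => term w,
    sum_measureReal_preimage_mul (measurable_block r N)
      (fun w => N * Real.log 2 + D (y w) * Real.log m)]
  simp only [hDy]
  have hsum : ∀ x : DyckShift m, (D x : ℝ) =
      ∑ i ∈ Finset.range N, {x : DyckShift m | Fresh (shape x.1) r (r + i)}.indicator 1 x := by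
    intro x
    have h1 : freshSet (shape x.1) r (r + N) =
        ((Finset.range N).filter fun i : ℕ => Fresh (shape x.1) r (r + i)).image
          fun i : ℕ => r + (i : ℤ) := by
      ext n
      simp only [mem_freshSet, Finset.mem_image, Finset.mem_filter, Finset.mem_range]
      constructor
      · rintro ⟨⟨h1, h2⟩, h3⟩
        have h4 : r + ((n - r).toNat : ℤ) = n := by omega
        exact ⟨(n - r).toNat, ⟨by omega, by rwa [h4]⟩, h4⟩
      · rintro ⟨i, ⟨h1, h2⟩, rfl⟩
        exact ⟨by omega, h2⟩
    simp only [hD]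
    rw [h1, Finset.card_image_of_injective _ fun i j h => by simpa using h,
      Finset.card_filter]
    push_cast
    refine Finset.sum_congr rfl fun i _ => ?_
    simp [Set.indicator_apply]
  have hms : ∀ i : ℕ, MeasurableSet {x : DyckShift m | Fresh (shape x.1) r (r + i)} := fun i =>
    measurable_subtype_coe (measurableSet_fresh r (r + i))
  have hint : ∀ i : ℕ, Integrable ({x : DyckShift m | Fresh (shape x.1) r (r + i)}.indicator
      (1 : DyckShift m → ℝ)) (thirdMeasure m) := fun i =>
    (integrable_const (1 : ℝ)).indicator (hms i)
  have hDint : ∫ x, (D x : ℝ) ∂thirdMeasure m = ∑ i ∈ Finset.range N, freshProb m i := by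
    simp only [hsum]
    rw [integral_finsetSum _ fun i _ => hint i]
    refine Finset.sum_congr rfl fun i _ => ?_
    rw [integral_indicator_one (hms i), measureReal_fresh]
  have hDi : Integrable (fun x => (D x : ℝ)) (thirdMeasure m) := by
    simp only [hsum]
    exact integrable_finsetSum _ fun i _ => hint i
  rw [integral_add (integrable_const _) (hDi.mul_const _), integral_const, integral_mul_const, hDint]
  simp [windowEntropy, mul_comm]

theorem freshProb_mem [NeZero m] (i : ℕ) : 0 ≤ freshProb m i ∧ freshProb m i ≤ 1 :=
  ⟨measureReal_nonneg, measureReal_le_one⟩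

/-- The events decrease, up to a null set, to the event of an opening bracket at 0, since almost
surely every closing bracket has a partner. -/
theorem tendsto_freshProb [NeZero m] : Tendsto (freshProb m) atTop (nhds (1 / 2)) := by
  set E : ℕ → Set (ℤ → DyckLetter m) := fun i => {x | Fresh (shape x) (-i) 0} with hE
  have hanti : Antitone E := by
    rintro i j hij x (hx | hx)
    · exact Or.inl hx
    · exact Or.inr fun l h1 h2 => hx l (by omega) h2
  have hlim := tendsto_measure_iInter_atTop (μ := dyckLaw m)
    (fun i : ℕ => (measurableSet_fresh (m := m) (-(i : ℤ)) 0).nullMeasurableSet) hanti ⟨0, measure_ne_top _ _⟩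
  have hval : dyckLaw m (⋂ i, E i) = 2⁻¹ := by
    have h1 : dyckLaw m (⋂ i, E i) = dyckLaw m {x | shape x 0 = true} := by
      refine measure_congr ?_
      filter_upwards [dyckLaw_ae_shape_mem] with x hx
      refine propext ⟨fun h => ?_, fun h => Set.mem_iInter.2 fun i => Or.inl h⟩
      obtain ⟨l, h2, h3⟩ := exists_left_le hx 0 (height (shape x) (0 + 1))
      refine ((Set.mem_iInter.1 h l.natAbs : Fresh _ _ _)).resolve_right fun h4 => ?_
      have := h4 l (by omega) h2
      omega
    have hme : MeasurableSet {x : ℤ → DyckLetter m | shape x 0 = true} :=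
      measurableSet_eq_fun ((measurable_pi_apply 0).comp measurable_shape) measurable_const
    have h2 : colourMap m ⁻¹' {x | shape x 0 = true} = {z : ℤ → Bool | z 0 = true} ×ˢ Set.univ := by
      ext p
      simp [shape_colourMap]
    rw [h1, dyckLaw_eq_map, Measure.map_apply (measurable_colourMap m) hme, h2, Measure.prod_prod,
      measure_univ, mul_one]
    have := symmetricProduct_agree (A := Bool) {0} (fun n => n) Function.injective_id.injOn
      fun _ => true
    simpa using this
  rw [hval] at hlim
  have := (ENNReal.tendsto_toReal (by simp)).comp hlim
  rw [ENNReal.toReal_inv, ENNReal.toReal_ofNat] at this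
  rw [one_div]
  exact this

theorem tendsto_windowEntropy [NeZero m] :
    Tendsto (fun n : ℕ => windowEntropy m n / n) atTop
      (nhds (Real.log 2 + (1 / 2) * Real.log m)) := by
  have h := ((tendsto_freshProb (m := m)).cesaro.const_mul (Real.log m)).const_add (Real.log 2)
  rw [mul_comm (1 / 2 : ℝ)]
  refine h.congr' ?_
  filter_upwards [eventually_gt_atTop 0] with n hn
  have : (n : ℝ) ≠ 0 := by exact_mod_cast hn.ne'
  unfold windowEntropy
  field_simp

theorem windowEntropy_add_le [NeZero m] (n c : ℕ) :
    windowEntropy m (n + c) ≤ windowEntropy m n + c * (Real.log 2 + Real.log m) := by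
  have hm : 0 ≤ Real.log m := Real.log_natCast_nonneg m
  induction c with
  | zero => simp
  | succ c ih =>
    have h1 := (freshProb_mem (m := m) (n + c)).2
    have h2 : windowEntropy m (n + (c + 1)) =
        windowEntropy m (n + c) + Real.log 2 + Real.log m * freshProb m (n + c) := by
      unfold windowEntropy
      rw [← add_assoc n c 1, Finset.sum_range_succ]
      push_cast
      ring
    rw [h2]
    push_cast
    nlinarith

theorem DyckShift.iterate_shift_apply (x : DyckShift m) (n : ℕ) (i : ℤ) :
    (DyckShift.shift^[n] x).1 i = x.1 (i + n) := by
  induction n generalizing x with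
  | zero => simp
  | succ n ih =>
    rw [Function.iterate_succ_apply, ih]
    change x.1 (i + n + 1) = _
    push_cast
    rw [add_assoc]

/-! ### Approximation of partitions by cylinders -/

/-- The map `f` depends on the coordinates in `[-k, k]` only. -/
def DependsOnWindow {β : Type*} (k : ℕ) (f : DyckShift m → β) : Prop :=
  ∀ x x' : DyckShift m, (∀ n : ℤ, -k ≤ n → n ≤ k → x.1 n = x'.1 n) → f x = f x'

theorem DependsOnWindow.mono {β : Type*} {k l : ℕ} {f : DyckShift m → β}
    (h : DependsOnWindow k f) (hkl : k ≤ l) : DependsOnWindow l f :=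
  fun x x' hx => h x x' fun n h1 h2 => hx n (by omega) (by omega)

/-- The algebra of cylinder sets. -/
def cylinderAlgebra (m : ℕ) : Set (Set (DyckShift m)) := {s | ∃ k, DependsOnWindow k (· ∈ s)}

theorem isSetAlgebra_cylinderAlgebra : IsSetAlgebra (cylinderAlgebra m) where
  empty_mem := ⟨0, fun _ _ _ => rfl⟩
  compl_mem := by
    rintro s ⟨k, h⟩
    exact ⟨k, fun x x' hx => congrArg Not (h x x' hx)⟩
  union_mem := by
    rintro s t ⟨k, h⟩ ⟨l, h'⟩
    exact ⟨max k l, fun x x' hx => congrArg₂ Or (h.mono (le_max_left k l) x x' hx)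
      (h'.mono (le_max_right k l) x x' hx)⟩

theorem DependsOnWindow.exists_factor {β : Type*} [Nonempty β] {k : ℕ} {f : DyckShift m → β}
    (h : DependsOnWindow k f) :
    ∃ φ : (Set.Ico (-(k : ℤ)) (k + 1) → DyckLetter m) → β, ∀ x, f x = φ (window k x.1) := by
  have hf : f.FactorsThrough fun x : DyckShift m => window k x.1 := fun x x' hx =>
    h x x' fun n h1 h2 => congrFun hx ⟨n, h1, by omega⟩
  exact ⟨Function.extend (fun x : DyckShift m => window k x.1) f fun _ => Classical.arbitrary β,
    fun x => (hf.extend_apply _ x).symm⟩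

theorem DependsOnWindow.measurable {β : Type*} [MeasurableSpace β] [Nonempty β] {k : ℕ}
    {f : DyckShift m → β} (h : DependsOnWindow k f) : Measurable f := by
  obtain ⟨φ, hφ⟩ := h.exists_factor
  rw [funext hφ]
  exact (measurable_of_countable φ).comp ((measurable_window k).comp measurable_subtype_coe)

theorem generateFrom_cylinderAlgebra :
    (inferInstance : MeasurableSpace (DyckShift m)) =
      MeasurableSpace.generateFrom (cylinderAlgebra m) := by
  apply le_antisymm
  · have h : Measurable[MeasurableSpace.generateFrom (cylinderAlgebra m)]
        (Subtype.val : DyckShift m → ℤ → DyckLetter m) := by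
      refine @measurable_pi_lambda _ _ _ (_) _ _ fun n => ?_
      intro t _
      refine MeasurableSpace.measurableSet_generateFrom ⟨n.natAbs, fun x x' hx => ?_⟩
      change (x.1 n ∈ t) = (x'.1 n ∈ t)
      rw [hx n (by omega) (by omega)]
    exact h.comap_le
  · refine MeasurableSpace.generateFrom_le ?_
    rintro s ⟨k, hk⟩
    exact measurableSet_setOfPred.2 hk.measurable

theorem exists_dependsOnWindow_approx [NeZero m] {k : ℕ} {P : DyckShift m → Fin k}
    (hP : Measurable P) {ε : ℝ} (hε : 0 < ε) :
    ∃ (M : ℕ) (Q : DyckShift m → Fin k), DependsOnWindow M Q ∧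
      (thirdMeasure m).real {x | P x ≠ Q x} ≤ ε := by
  obtain ⟨x₀⟩ : Nonempty (DyckShift m) := (thirdMeasure m).nonempty_of_neZero
  have hk : 0 < k := (P x₀).pos
  have : Nonempty (Fin k) := ⟨P x₀⟩
  have hd : (thirdMeasure m).MeasureDense (cylinderAlgebra m) :=
    .of_generateFrom_isSetAlgebra_finite _ isSetAlgebra_cylinderAlgebra generateFrom_cylinderAlgebra
  have happ : ∀ j : Fin k, ∃ t ∈ cylinderAlgebra m,
      thirdMeasure m (symmDiff (P ⁻¹' {j}) t) < ENNReal.ofReal (ε / k) := fun j =>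
    hd.approx _ (hP (measurableSet_singleton j)) (measure_ne_top _ _) _ (by positivity)
  choose t ht hlt using happ
  choose M hM using ht
  -- The chosen label depends only on which `t j` contain `x`. Outside all the symmetric differences
  -- only `t (P x)` does, so the label is then `P x`.
  refine ⟨Finset.univ.sup M, fun x => Classical.epsilon fun j => x ∈ t j, fun x x' hx => ?_, ?_⟩
  · have : (fun j => x ∈ t j) = fun j => x' ∈ t j := funext fun j =>
      (hM j).mono (Finset.le_sup (f := M) (Finset.mem_univ j)) x x' hx
    simp only [this]
  · have hsub : {x | P x ≠ Classical.epsilon fun j => x ∈ t j} ⊆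
        ⋃ j, symmDiff (P ⁻¹' {j}) (t j) := by
      intro x hx
      by_contra hc
      simp only [Set.mem_iUnion, not_exists, Set.mem_symmDiff, Set.mem_preimage,
        Set.mem_singleton_iff, not_or, not_and, not_not] at hc
      have h1 : x ∈ t (P x) := (hc (P x)).1 rfl
      have h2 : x ∈ t (Classical.epsilon fun j => x ∈ t j) :=
        Classical.epsilon_spec (p := fun j => x ∈ t j) ⟨_, h1⟩
      exact hx ((hc _).2 h2)
    calc (thirdMeasure m).real {x | P x ≠ Classical.epsilon fun j => x ∈ t j}
        ≤ (thirdMeasure m).real (⋃ j, symmDiff (P ⁻¹' {j}) (t j)) := measureReal_mono hsub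
      _ ≤ ∑ j, (thirdMeasure m).real (symmDiff (P ⁻¹' {j}) (t j)) := measureReal_iUnion_fintype_le _
      _ ≤ ∑ _j : Fin k, ε / k := Finset.sum_le_sum fun j _ =>
          ENNReal.toReal_le_of_le_ofReal (by positivity) (hlt j).le
      _ = ε := by
          rw [Finset.sum_const, Finset.card_univ, Fintype.card_fin, nsmul_eq_mul]
          field_simp

/-! ### The letter at zero is a generating partition -/

theorem measurable_itinerary {k : ℕ} {P : DyckShift m → Fin k} (hP : Measurable P) (n : ℕ) :
    Measurable (itinerary DyckShift.shift P n) :=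
  measurable_pi_lambda _ fun i => hP.comp (measurable_dyckShift_shift.iterate i)

theorem exists_encoding_cost (k : ℕ) {ε : ℝ} (hε : 0 < ε) :
    ∃ C, 0 ≤ C ∧ Real.exp (-ε) + k * Real.exp (-C) ≤ 1 := by
  have h1 : Real.exp (-ε) < 1 := Real.exp_lt_one_iff.2 (by linarith)
  have h2 : Tendsto (fun C : ℝ => Real.exp (-ε) + k * Real.exp (-C)) atTop
      (nhds (Real.exp (-ε) + k * 0)) :=
    ((Real.tendsto_exp_neg_atTop_nhds_zero).const_mul _).const_add _
  rw [mul_zero, add_zero] at h2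
  obtain ⟨C, hC, hC0⟩ := ((h2.eventually (gt_mem_nhds h1)).and (eventually_ge_atTop 0)).exists
  exact ⟨C, hC0, hC.le⟩

/-- A slightly longer window determines the itinerary of an approximating partition `Q`. Given this
prediction, the itinerary of `P` is encoded symbol by symbol, cheaply where the prediction is right,
at cost `C` where it is wrong. -/
theorem shannonEntropy_itinerary_le [NeZero m] {k : ℕ} {P : DyckShift m → Fin k}
    (hP : Measurable P) {ε : ℝ} (hε : 0 < ε) :
    ∃ c : ℕ, ∀ n : ℕ, shannonEntropy (thirdMeasure m) (itinerary DyckShift.shift P n) ≤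
      windowEntropy m (n + c) + n * ε := by
  obtain ⟨C, hC0, hC⟩ := exists_encoding_cost k (half_pos hε)
  -- With this error probability wrong predictions cost at most `ε / 2` per symbol on average; right
  -- ones cost at most another `ε / 2`.
  obtain ⟨M, Q, hQ, hPQ⟩ := exists_dependsOnWindow_approx (m := m) hP
    (ε := ε / 2 / (C + 1)) (by positivity)
  have hne : Nonempty (Fin k) := by
    obtain ⟨x₀⟩ : Nonempty (DyckShift m) := (thirdMeasure m).nonempty_of_neZero
    exact ⟨P x₀⟩
  refine ⟨2 * M + 1, fun n => ?_⟩
  set g := block (m := m) (-M) (n + (2 * M + 1)) with hg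
  -- the cost of the symbol `a` when `b` is predicted
  set cost : Fin k → Fin k → ℝ := fun b a => if a = b then ε / 2 else C with hcost
  have hcost1 : ∀ b, ∑ a, Real.exp (-cost b a) ≤ 1 := by
    intro b
    refine le_trans ?_ hC
    calc ∑ a, Real.exp (-cost b a)
        ≤ ∑ a, ((if a = b then Real.exp (-(ε / 2)) else 0) + Real.exp (-C)) := by
          refine Finset.sum_le_sum fun a _ => ?_
          simp only [hcost]
          have := Real.exp_pos (-C)
          split_ifs <;> linarith
      _ = _ := by simp [Finset.sum_add_distrib]
  -- the predictions are functions of the window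
  have hfac : ∀ j : Fin n, ∃ φ : (Fin (n + (2 * M + 1)) → DyckLetter m) → Fin k,
      ∀ x, Q (DyckShift.shift^[j] x) = φ (g x) := by
    intro j
    have hf : (fun x : DyckShift m => Q (DyckShift.shift^[j] x)).FactorsThrough g := by
      intro x x' hx
      refine hQ _ _ fun i h1 h2 => ?_
      rw [DyckShift.iterate_shift_apply, DyckShift.iterate_shift_apply]
      have := congrFun hx ⟨(i + j + M).toNat, by have := j.2; omega⟩
      simp only [hg, block] at this
      rwa [show -(M : ℤ) + ((i + j + M).toNat : ℤ) = i + (j : ℕ) by omega] at this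
    exact ⟨Function.extend g (fun x : DyckShift m => Q (DyckShift.shift^[j] x))
      fun _ => Classical.arbitrary _, fun x => (hf.extend_apply _ x).symm⟩
  choose φ hφ using hfac
  have hsum : ∀ w, ∑ i : Fin n → Fin k, Real.exp (-∑ j, cost (φ j w) (i j)) ≤ 1 := by
    intro w
    calc ∑ i : Fin n → Fin k, Real.exp (-∑ j, cost (φ j w) (i j))
        = ∑ i : Fin n → Fin k, ∏ j, Real.exp (-cost (φ j w) (i j)) := by
          refine Finset.sum_congr rfl fun i _ => ?_
          rw [← Finset.sum_neg_distrib, Real.exp_sum]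
      _ = ∏ j, ∑ a, Real.exp (-cost (φ j w) a) := by
          rw [Finset.prod_univ_sum, Fintype.piFinset_univ]
      _ ≤ 1 := Finset.prod_le_one
          (fun j _ => Finset.sum_nonneg fun a _ => (Real.exp_pos _).le) fun j _ => hcost1 _
  have h := shannonEntropy_le_add (μ := thirdMeasure m) (measurable_itinerary hP n)
    (measurable_block (-M) (n + (2 * M + 1))) hsum
  rw [shannonEntropy_block] at h
  refine h.trans (add_le_add_right ?_ _)
  have hQm := hQ.measurable
  have hcm : Measurable fun q : Fin k × Fin k => cost q.1 q.2 := measurable_of_countable _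
  have hcQP : Measurable fun x => cost (Q x) (P x) := hcm.comp (hQm.prodMk hP)
  have hb : ∀ b a, |cost b a| ≤ ε / 2 + C := fun b a => by
    simp only [hcost]
    split_ifs <;> rw [abs_of_nonneg (by positivity)] <;> linarith
  have hi : ∀ j : ℕ, Integrable (fun x => cost (Q (DyckShift.shift^[j] x))
      (P (DyckShift.shift^[j] x))) (thirdMeasure m) := fun j =>
    Integrable.of_bound (hcQP.comp (measurable_dyckShift_shift.iterate j)).aestronglyMeasurable
      (ε / 2 + C) (Eventually.of_forall fun x => hb _ _)
  have h1 : ∫ x, cost (Q x) (P x) ∂thirdMeasure m ≤ ε := by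
    have hms : MeasurableSet {x | P x ≠ Q x} := (measurableSet_eq_fun hP hQm).compl
    calc ∫ x, cost (Q x) (P x) ∂thirdMeasure m
        ≤ ∫ x, (ε / 2 + {x | P x ≠ Q x}.indicator (fun _ => C) x) ∂thirdMeasure m := by
          refine integral_mono (hi 0) ((integrable_const _).add
            ((integrable_const _).indicator hms)) fun x => ?_
          simp only [hcost, Set.indicator_apply, Set.mem_ofPred_eq, ne_eq]
          split_ifs <;> first | contradiction | linarith
      _ = ε / 2 + (thirdMeasure m).real {x | P x ≠ Q x} * C := by
          rw [integral_add (integrable_const _) ((integrable_const _).indicator hms),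
            integral_indicator_const _ hms]
          simp
      _ ≤ ε / 2 + ε / 2 / (C + 1) * C := by gcongr
      _ ≤ ε := by
          have : ε / 2 / (C + 1) * C ≤ ε / 2 := by
            rw [div_mul_eq_mul_div, div_le_iff₀ (by positivity)]
            nlinarith
          linarith
  calc ∫ x, ∑ j, cost (φ j (block (-M) (n + (2 * M + 1)) x)) (itinerary DyckShift.shift P n x j)
        ∂thirdMeasure m
      = ∫ x, ∑ j : Fin n, cost (Q (DyckShift.shift^[j] x)) (P (DyckShift.shift^[j] x))
          ∂thirdMeasure m := by
        simp only [hφ]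
        rfl
    _ = ∑ _j : Fin n, ∫ x, cost (Q x) (P x) ∂thirdMeasure m := by
        rw [integral_finsetSum (f := fun (j : Fin n) x => cost (Q (DyckShift.shift^[j] x))
          (P (DyckShift.shift^[j] x))) _ fun j _ => hi j]
        refine Finset.sum_congr rfl fun j _ => ?_
        have hmp := (measurePreserving_shift (m := m)).iterate j
        have := integral_map (μ := thirdMeasure m) hmp.measurable.aemeasurable
          (f := fun x => cost (Q x) (P x)) hcQP.aestronglyMeasurable
        rw [hmp.map_eq] at this
        exact this.symm
    _ ≤ ∑ _j : Fin n, ε := Finset.sum_le_sum fun _ _ => h1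
    _ = n * ε := by simp

theorem partitionEntropy_le [NeZero m] {k : ℕ} {P : DyckShift m → Fin k} (hP : Measurable P) :
    partitionEntropy (thirdMeasure m) DyckShift.shift P ≤
      ((Real.log 2 + (1 / 2) * Real.log m : ℝ) : EReal) := by
  by_contra hlt
  obtain ⟨c, hc1, hc2⟩ := EReal.lt_iff_exists_real_btwn.1 (not_le.1 hlt)
  rw [EReal.coe_lt_coe_iff] at hc1
  set L := Real.log 2 + (1 / 2) * Real.log m with hL
  -- Allowing the error `c - L` per symbol makes the upper bounds converge to `c`; the `d` extra
  -- letters disappear after division by `n`.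
  obtain ⟨d, hd⟩ := shannonEntropy_itinerary_le hP (sub_pos.2 hc1)
  have hlim : Tendsto (fun n : ℕ => windowEntropy m n / n +
      (d * (Real.log 2 + Real.log m)) / n + (c - L)) atTop (nhds (L + 0 + (c - L))) :=
    (tendsto_windowEntropy.add (tendsto_const_div_atTop_nhds_zero_nat _)).add_const _
  rw [show L + 0 + (c - L) = c by ring] at hlim
  refine hc2.not_ge ?_
  unfold partitionEntropy
  rw [← ((continuous_coe_real_ereal.tendsto c).comp hlim).limsup_eq]
  refine limsup_le_limsup ?_
  filter_upwards [eventually_gt_atTop 0] with n hn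
  have hn' : (0 : ℝ) < n := by exact_mod_cast hn
  rw [Function.comp_apply, EReal.coe_le_coe_iff, ← add_div, div_add' _ _ _ hn'.ne']
  refine div_le_div_of_nonneg_right ?_ hn'.le
  have := hd n
  have := windowEntropy_add_le (m := m) n d
  linarith

theorem partitionEntropy_letter [NeZero m] :
    partitionEntropy (thirdMeasure m) DyckShift.shift
      (fun x : DyckShift m => Fintype.equivFin (DyckLetter m) (x.1 0)) =
      ((Real.log 2 + (1 / 2) * Real.log m : ℝ) : EReal) := by
  have h : ∀ n, shannonEntropy (thirdMeasure m) (itinerary DyckShift.shift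
      (fun x : DyckShift m => Fintype.equivFin (DyckLetter m) (x.1 0)) n) = windowEntropy m n := by
    intro n
    rw [← shannonEntropy_block 0 n, ← shannonEntropy_comp_equiv (block 0 n)
      ((Equiv.refl (Fin n)).arrowCongr (Fintype.equivFin (DyckLetter m)))]
    congr 1
    funext x i
    simp only [itinerary, DyckShift.iterate_shift_apply]
    rfl
  unfold partitionEntropy
  simp only [h]
  exact ((continuous_coe_real_ereal.tendsto _).comp tendsto_windowEntropy).limsup_eq

theorem measureEntropy_thirdMeasure [NeZero m] :
    measureEntropy (thirdMeasure m) DyckShift.shift =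
      ((Real.log 2 + (1 / 2) * Real.log m : ℝ) : EReal) := by
  refine le_antisymm (iSup_le fun k => iSup_le fun P => iSup_le fun hP => partitionEntropy_le hP) ?_
  rw [← partitionEntropy_letter]
  have hm : Measurable fun x : DyckShift m => Fintype.equivFin (DyckLetter m) (x.1 0) :=
    (measurable_of_countable _).comp ((measurable_pi_apply 0).comp measurable_subtype_coe)
  exact le_iSup_of_le _ (le_iSup_of_le _ (le_iSup_of_le hm le_rfl))

/-! ### Topological entropy -/

/-- The colour of an opening bracket. -/
def DyckLetter.pushed {m : ℕ} : DyckLetter m → Option (Fin m)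
  | alpha j => some j
  | beta _ => none

/-- Colours are prescribed for opening brackets only, where they sit at distinct indices;
`colourMap` then supplies the colours of the closing ones. -/
theorem exists_point_of_pushes [NeZero m] {N : ℕ} (c : Fin N → Option (Fin m)) :
    ∃ x : DyckShift m, ∀ k : Fin N, (x.1 (k : ℕ)).pushed = c k := by
  classical
  set z : ℤ → Bool := fun n => if h : ∃ k : Fin N, ((k : ℕ) : ℤ) = n then (c h.choose).isSome
    else true with hz
  have hzk : ∀ k : Fin N, z (k : ℕ) = (c k).isSome := by
    intro k
    have h : ∃ k' : Fin N, ((k' : ℕ) : ℤ) = (k : ℕ) := ⟨k, rfl⟩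
    have h1 : h.choose = k := by have := h.choose_spec; omega
    simp only [hz, dif_pos h, h1]
  set a : ℤ → Fin m := fun i => if h : ∃ k : Fin N, z (k : ℕ) = true ∧ onesIndex z (k : ℕ) = i
    then (c h.choose).getD 0 else 0 with ha
  have hak : ∀ k : Fin N, z (k : ℕ) = true → a (onesIndex z (k : ℕ)) = (c k).getD 0 := by
    intro k hk
    have h : ∃ k' : Fin N, z (k' : ℕ) = true ∧ onesIndex z (k' : ℕ) = onesIndex z (k : ℕ) :=
      ⟨k, hk, rfl⟩
    have h1 : h.choose = k := by
      have := onesIndex_injOn z h.choose_spec.1 hk h.choose_spec.2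
      omega
    simp only [ha, dif_pos h, h1]
  refine ⟨⟨colourMap m (z, a), colourMap_mem _⟩, fun k => ?_⟩
  cases hc : c k with
  | none =>
    have : z (k : ℕ) = false := by rw [hzk, hc]; rfl
    simp [colourMap, this, DyckLetter.pushed]
  | some j =>
    have h1 : z (k : ℕ) = true := by rw [hzk, hc]; rfl
    have h2 := hak k h1
    rw [hc, Option.getD_some] at h2
    simp [colourMap, h1, h2, DyckLetter.pushed]

theorem letter_entourage_mem (m : ℕ) :
    {p : DyckShift m × DyckShift m | p.1.1 0 = p.2.1 0} ∈ uniformity (DyckShift m) := by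
  have : DiscreteUniformity (DyckLetter m) := ⟨rfl⟩
  have h : UniformContinuous fun x : DyckShift m => x.1 0 :=
    (Pi.uniformContinuous_proj (fun _ : ℤ => DyckLetter m) 0).comp uniformContinuous_subtype_val
  exact h (DiscreteUniformity.relId_mem_uniformity _)

/-- The `(m + 1)^N` patterns of pushes give points whose dynamical balls for the entourage "same
letter at zero" are pairwise disjoint, since all points of a ball share their first `N` letters. -/
theorem log_le_coverEntropy [NeZero m] :
    ((Real.log (m + 1) : ℝ) : EReal) ≤
      Dynamics.coverEntropy (DyckShift.shift (m := m)) Set.univ := by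
  classical
  set U : SetRel (DyckShift m) (DyckShift m) := {p | p.1.1 0 = p.2.1 0} with hU
  refine le_trans ?_ (Dynamics.netEntropyEntourage_le_coverEntropy _ _ (letter_entourage_mem m))
  have hcard : ∀ N : ℕ, (((m + 1) ^ N : ℕ) : ℕ∞) ≤
      Dynamics.netMaxcard (DyckShift.shift (m := m)) Set.univ U N := by
    intro N
    choose x hx using fun c : Fin N → Option (Fin m) => exists_point_of_pushes c
    have hinj : Function.Injective x := fun c c' h => funext fun k => by
      rw [← hx c k, ← hx c' k, h]
    have hnet : Dynamics.IsDynNetIn (DyckShift.shift (m := m)) Set.univ U N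
        (Finset.univ.image x : Finset (DyckShift m)) := by
      refine ⟨Set.subset_univ _, ?_⟩
      intro p hp q hq hpq
      rw [Finset.mem_coe, Finset.mem_image] at hp hq
      obtain ⟨c, -, rfl⟩ := hp
      obtain ⟨c', -, rfl⟩ := hq
      refine Set.disjoint_left.2 fun w h1 h2 => hpq (congrArg x (funext fun k => ?_))
      have e1 := Dynamics.mem_dynEntourage.1 h1 k k.2
      have e2 := Dynamics.mem_dynEntourage.1 h2 k k.2
      simp only [hU, Set.mem_ofPred_eq, DyckShift.iterate_shift_apply, zero_add] at e1 e2
      rw [← hx c k, ← hx c' k, e1, e2]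
    have := hnet.card_le_netMaxcard
    rw [Finset.card_image_of_injective _ hinj, Finset.card_univ] at this
    simpa using this
  have hpow : ExpGrowth.expGrowthSup (fun N : ℕ => ((m + 1 : ℕ) : ENNReal) ^ N) ≤
      Dynamics.netEntropyEntourage (DyckShift.shift (m := m)) Set.univ U := by
    refine ExpGrowth.expGrowthSup_monotone fun N => ?_
    have := ENat.toENNReal_mono (hcard N)
    simpa using this
  refine le_trans ?_ hpow
  rw [ExpGrowth.expGrowthSup_pow, ← ENNReal.ofReal_natCast,
    ENNReal.log_ofReal_of_pos (by positivity)]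
  push_cast
  exact le_rfl

/-- After doubling and exponentiating this is `4m < (m + 1)^2`, that is, `(m - 1)^2 > 0`. -/
theorem entropy_lt_log (hm : 2 ≤ m) :
    Real.log 2 + (1 / 2) * Real.log m < Real.log (m + 1) := by
  have h0 : (2 : ℝ) ≤ m := by exact_mod_cast hm
  have h1 : Real.log 2 + (1 / 2) * Real.log m = (1 / 2) * Real.log (4 * m) := by
    rw [Real.log_mul (by norm_num) (by positivity), show (4 : ℝ) = 2 ^ 2 by norm_num, Real.log_pow]
    push_cast
    ring
  have h2 : Real.log (m + 1) = (1 / 2) * Real.log ((m + 1) ^ 2) := by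
    rw [Real.log_pow]
    push_cast
    ring
  rw [h1, h2]
  have := Real.log_lt_log (x := 4 * (m : ℝ)) (y := ((m : ℝ) + 1) ^ 2) (by positivity)
    (by nlinarith)
  linarith

end

theorem mainTheorem6 (m : ℕ) (hm : 1 ≤ m) :
    IsProbabilityMeasure (thirdMeasure m) ∧
    MeasurePreserving (DyckShift.shift (m := m)) (thirdMeasure m) (thirdMeasure m) ∧
    DoubleTailInvariant (thirdMeasure m) ∧
    measureEntropy (thirdMeasure m) DyckShift.shift
      = ((Real.log 2 + (1 / 2) * Real.log m : ℝ) : EReal) ∧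
    (2 ≤ m →
      measureEntropy (thirdMeasure m) DyckShift.shift
        < Dynamics.coverEntropy (DyckShift.shift (m := m)) Set.univ) := by
  have : NeZero m := ⟨by omega⟩
  refine ⟨inferInstance, measurePreserving_shift, doubleTailInvariant_thirdMeasure,
    measureEntropy_thirdMeasure, fun h2 => ?_⟩
  rw [measureEntropy_thirdMeasure]
  exact (EReal.coe_lt_coe_iff.2 (entropy_lt_log h2)).trans_le log_le_coverEntropy
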